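/- Let $d\sigma=(2\pi)^{-1}d\theta$ be the uniform probability measure on $\mathbb S^1\approx[0,2\pi)$, let $\|\cdot\|_q$ be the norm of $\mathrm L^q(\mathbb S^1,d\sigma)$, and let $\mathrm H^1(\mathbb S^1)$ (resp. $\mathrm H^1(\mathbb S^1,\mathbb C)$) be the space of real (resp. complex) valued continuous $2\pi$-periodic functions whose weak derivative is in $\mathrm L^2$. For $u\in\mathrm H^1(\mathbb S^1)$ write $\|u^{-1}\|_2^{-2}=\big(\int_{\mathbb S^1}u^{-2}\,d\sigma\big)^{-1}$, with the convention that this is $0$ if $u^{-2}$ is not integrable. For $1<p<2$, $0<a<1/2$ and $\mu>0$, let $$\lambda_{a,p}(\mu)=\inf\Big\{\|\psi'-i\,a\,\psi\|_2^2+\mu\,\|\psi\|_p^2\;:\;\psi\in\mathrm H^1(\mathbb S^1,\mathbb C),\ \|\psi\|_2=1\Big\}.$$ **Theorem 3.5.** Let $1<p<2$, $0<a<1/2$ and $\mu>0$. Then $\lambda_{a,p}(\mu)$ is also the optimal (largest possible) constant in the inequality $$\|u'\|_2^2+a^2\,\|u^{-1}\|_2^{-2}+\mu\,\|u\|_p^2\;\ge\;\lambda_{a,p}(\mu)\,\|u\|_2^2\qquad\forall\,u\in\mathrm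 H^1(\mathbb S^1),\tag{$*$}$$ and moreover: (i) If $\mu\,(2-p)+4\,a^2\le1$, then $\lambda_{a,p}(\mu)=a^2+\mu$, and a function $u\in\mathrm H^1(\mathbb S^1)$ satisfies $(*)$ with equality if and only if it is constant. (ii) If $\mu\,(2-p)+4\,a^2>1$, then $\lambda_{a,p}(\mu)<a^2+\mu$, and no non-zero constant function satisfies $(*)$ with equality. -/

import Mathlib

open MeasureTheory Set
open scoped ENNReal

noncomputable section

namespace MagneticRing

/-- The uniform probability measure `dσ = (2π)⁻¹ dθ` on the circle, carried by the fundamental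
domain `(0, 2π]`; functions on the circle are `2π`-periodic functions on `ℝ`. -/
def circleMeasure : Measure ℝ :=
  (ENNReal.ofReal (2 * Real.pi))⁻¹ • volume.restrict (Ioc 0 (2 * Real.pi))

/-- The space `H¹(S¹)` of real (`𝕜 = ℝ`) or complex (`𝕜 = ℂ`) valued functions: `2π`-periodic,
(locally) absolutely continuous functions whose almost everywhere defined derivative is square
integrable over a period. In one dimension these are the continuous representatives of the periodic
functions in `L²` with a weak derivative in `L²`; the weak derivative is `deriv u`. -/
structure MemH1 {𝕜 : Type*} [RCLike 𝕜] (u : ℝ → 𝕜) : Prop where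
  periodic : Function.Periodic u (2 * Real.pi)
  absolutelyContinuous : AbsolutelyContinuousOnInterval u 0 (2 * Real.pi)
  memLp_deriv : MemLp (deriv u) 2 circleMeasure

/-- The norm of `L^q(S¹, dσ)`. -/
def lqNorm {𝕜 : Type*} [RCLike 𝕜] (q : ℝ≥0∞) (f : ℝ → 𝕜) : ℝ :=
  (eLpNorm f q circleMeasure).toReal

/-- The quantity `‖u⁻¹‖₂⁻² = (∫ u⁻² dσ)⁻¹`. It is computed in `[0, ∞]`, where `0⁻¹ = ∞` and
`∞⁻¹ = 0`, so that it is `0` whenever `u⁻²` is not integrable. -/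
def invNormInvSq (u : ℝ → ℝ) : ℝ :=
  ((∫⁻ θ, (ENNReal.ofReal (u θ ^ 2))⁻¹ ∂circleMeasure)⁻¹).toReal

/-- `‖ψ' - i a ψ‖₂² + μ ‖ψ‖_p²` for a complex valued function `ψ`. -/
def magneticEnergy (a p μ : ℝ) (ψ : ℝ → ℂ) : ℝ :=
  lqNorm 2 (fun θ => deriv ψ θ - Complex.I * (a : ℂ) * ψ θ) ^ 2
    + μ * lqNorm (ENNReal.ofReal p) ψ ^ 2

/-- The optimal constant `λ_{a,p}(μ)` in
`‖ψ' - i a ψ‖₂² + μ ‖ψ‖_p² ≥ λ ‖ψ‖₂²` for all `ψ ∈ H¹(S¹, ℂ)`. -/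
def optimalConstant (a p μ : ℝ) : ℝ :=
  sInf {e : ℝ | ∃ ψ : ℝ → ℂ, MemH1 ψ ∧ lqNorm 2 ψ = 1 ∧ magneticEnergy a p μ ψ = e}

/-- `‖u'‖₂² + a² ‖u⁻¹‖₂⁻² + μ ‖u‖_p²` for a real valued function `u`. -/
def scalarEnergy (a p μ : ℝ) (u : ℝ → ℝ) : ℝ :=
  lqNorm 2 (deriv u) ^ 2 + a ^ 2 * invNormInvSq u + μ * lqNorm (ENNReal.ofReal p) u ^ 2

end MagneticRing

end

namespace MagneticRing

open Filter Topology

/-! ### The normalized measure on the circle -/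

/-! The magnetic problem becomes scalar by eliminating the phase. Write a non-vanishing `ψ` as `u
e^{iφ}`. Then `|ψ' - iaψ|² = u'² + (φ' - a)² u²`, and the mean of `φ'` is an integer `k`, the
winding number. By Cauchy–Schwarz the phase term costs at least `(k - a)² ‖u⁻¹‖₂⁻²`, and `0 < a <
1/2` makes `k = 0` the cheapest choice (`scalarEnergy_norm_le`). Conversely, for a positive `u` an
explicit periodic phase reaches `a² ‖u⁻¹‖₂⁻²` (`IsSmoothPos.exists_magneticEnergy_eq`).
Non-vanishing `ψ` suffice: trigonometric polynomials are dense in `H¹`, and a small translation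
moves the range of a smooth closed curve off the origin. On the scalar side, inequalities pass from
smooth positive functions to `H¹`, because `u ↦ ‖u⁻¹‖₂⁻²` is upper semicontinuous and enters with a
non-negative coefficient. This gives `isGreatest_optimalConstant`.

Below the threshold, the bound is `a²` times the critical inequality `‖u‖₂² ≤ 4‖u'‖₂² + ‖u⁻¹‖₂⁻²`
plus `μ` times Beckner's inequality `‖u‖₂² ≤ (2-p)‖u'‖₂² + ‖u‖_p²`. Together these use `(4a² +
μ(2-p))‖u'‖₂² ≤ ‖u'‖₂²`. The critical inequality is Wirtinger's inequality for the antiperiodic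
functions `u cos φ` and `u sin φ`, where `φ' ∝ u⁻²` and `φ` gains `π` per turn.

Beckner's inequality is an entropy – entropy production inequality for `f = u^p`, `q = 2/p`, proved
along the heat flow. Cauchy–Schwarz leaves an extra quadratic dissipation term
(`fisher_dissipation`), which improves the inequality by a logarithm (`HeatFlow.entropy_le`). To
carry this gain through approximation, the logarithm is replaced by all its tangent lines, indexed
by `σ ≥ 0`. Choosing `σ` at the very end, on `H¹`, gives strictness for non-constant functions
(`MemH1.beckner_strict`) and hence the equality case.

Above the threshold, the test function `1 + ε cos x` has an energy whose second-order expansion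
falls below that of the constants (`exists_scalarEnergy_lt`). -/

lemma integral_circleMeasure {E : Type*} [NormedAddCommGroup E] [NormedSpace ℝ E] (f : ℝ → E) :
    ∫ x, f x ∂circleMeasure = (2 * Real.pi)⁻¹ • ∫ x in (0 : ℝ)..(2 * Real.pi), f x := by
  rw [circleMeasure, integral_smul_measure, intervalIntegral.integral_of_le Real.two_pi_pos.le,
    ENNReal.toReal_inv, ENNReal.toReal_ofReal Real.two_pi_pos.le]

instance : IsProbabilityMeasure circleMeasure := by
  constructor
  rw [circleMeasure, Measure.smul_apply, Measure.restrict_apply_univ, Real.volume_Ioc, sub_zero,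
    smul_eq_mul, ENNReal.inv_mul_cancel _ ENNReal.ofReal_ne_top]
  simp [Real.pi_pos]

lemma ae_circleMeasure_of_forall_Ioc {P : ℝ → Prop} (h : ∀ x ∈ Ioc 0 (2 * Real.pi), P x) :
    ∀ᵐ x ∂circleMeasure, P x :=
  Measure.ae_smul_measure (ae_restrict_of_forall_mem measurableSet_Ioc h) _

lemma ae_circleMeasure_of_ae {P : ℝ → Prop}
    (h : ∀ᵐ x, x ∈ uIcc 0 (2 * Real.pi) → P x) : ∀ᵐ x ∂circleMeasure, P x := by
  refine Measure.ae_smul_measure ?_ _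
  rw [ae_restrict_iff' measurableSet_Ioc]
  filter_upwards [h] with x hx hx'
  exact hx (by rw [uIcc_of_le Real.two_pi_pos.le]; exact Ioc_subset_Icc_self hx')

lemma ae_restrict_of_ae_circleMeasure {P : ℝ → Prop} (h : ∀ᵐ x ∂circleMeasure, P x) :
    ∀ᵐ x ∂(volume.restrict (Ioc 0 (2 * Real.pi))), P x := by
  have hc : (ENNReal.ofReal (2 * Real.pi))⁻¹ ≠ 0 :=
    ENNReal.inv_ne_zero.2 ENNReal.ofReal_ne_top
  exact (Measure.absolutelyContinuous_smul hc).ae_le h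

lemma memLp_of_continuousOn {E : Type*} [NormedAddCommGroup E] [SecondCountableTopology E]
    {f : ℝ → E} (hf : ContinuousOn f (Icc 0 (2 * Real.pi)))
    (q : ℝ≥0∞) : MemLp f q circleMeasure := by
  obtain ⟨C, hC⟩ := isCompact_Icc.exists_bound_of_continuousOn hf
  refine MemLp.of_bound ?_ C (ae_circleMeasure_of_forall_Ioc fun x hx => hC x ⟨hx.1.le, hx.2⟩)
  refine AEStronglyMeasurable.smul_measure ?_ _
  exact (hf.mono Ioc_subset_Icc_self).aestronglyMeasurable measurableSet_Ioc

lemma memLp_of_continuous {E : Type*} [NormedAddCommGroup E] [SecondCountableTopology E]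
    {f : ℝ → E} (hf : Continuous f) (q : ℝ≥0∞) : MemLp f q circleMeasure :=
  memLp_of_continuousOn hf.continuousOn q

lemma integrable_of_continuous {E : Type*} [NormedAddCommGroup E] [SecondCountableTopology E]
    {f : ℝ → E} (hf : Continuous f) : Integrable f circleMeasure :=
  memLp_one_iff_integrable.1 (memLp_of_continuous hf 1)

/-- The mean over a period of the derivative of a periodic function vanishes. -/
lemma integral_deriv_eq_zero_of_periodic {F f : ℝ → ℝ} (hF : ∀ x, HasDerivAt F (f x) x)
    (hf : Continuous f) (hp : Function.Periodic F (2 * Real.pi)) :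
    ∫ x, f x ∂circleMeasure = 0 := by
  rw [integral_circleMeasure, intervalIntegral.integral_eq_sub_of_hasDerivAt (fun x _ => hF x)
    (hf.intervalIntegrable _ _)]
  have := hp 0
  rw [zero_add] at this
  simp [this]

section Norm

variable {𝕜 : Type*} [RCLike 𝕜]

lemma lqNorm_nonneg (q : ℝ≥0∞) (f : ℝ → 𝕜) : 0 ≤ lqNorm q f := ENNReal.toReal_nonneg

lemma lqNorm_two_sq {f : ℝ → 𝕜} (hf : MemLp f 2 circleMeasure) :
    lqNorm 2 f ^ 2 = ∫ x, ‖f x‖ ^ 2 ∂circleMeasure := by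
  have h := hf.eLpNorm_eq_integral_rpow_norm (by norm_num) (by norm_num)
  have h0 : 0 ≤ ∫ x, ‖f x‖ ^ 2 ∂circleMeasure := integral_nonneg fun x => by positivity
  simp only [ENNReal.toReal_ofNat, Real.rpow_two] at h
  rw [lqNorm, h, ENNReal.toReal_ofReal (by positivity), ← Real.rpow_natCast, ← Real.rpow_mul h0]
  norm_num

lemma lqNorm_sq_of_continuous {f : ℝ → 𝕜} (hf : Continuous f) {p : ℝ} (hp : 0 < p) :
    lqNorm (ENNReal.ofReal p) f ^ 2 = (∫ x, ‖f x‖ ^ p ∂circleMeasure) ^ (2 / p) := by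
  have hpp : ENNReal.ofReal p ≠ 0 := by simpa using hp
  have h := (memLp_of_continuous hf (ENNReal.ofReal p)).eLpNorm_eq_integral_rpow_norm hpp (by simp)
  have h0 : 0 ≤ ∫ x, ‖f x‖ ^ p ∂circleMeasure := integral_nonneg fun x => by positivity
  rw [ENNReal.toReal_ofReal hp.le] at h
  rw [lqNorm, h, ENNReal.toReal_ofReal (by positivity), ← Real.rpow_natCast, ← Real.rpow_mul h0]
  congr 1
  push_cast
  field_simp

lemma lqNorm_le_of_bound {f : ℝ → 𝕜} {C : ℝ} (hC : 0 ≤ C) (q : ℝ≥0∞)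
    (h : ∀ᵐ x ∂circleMeasure, ‖f x‖ ≤ C) : lqNorm q f ≤ C := by
  have := eLpNorm_le_of_ae_bound (p := q) h
  simp only [measure_univ, ENNReal.one_rpow, one_mul] at this
  exact ENNReal.toReal_le_of_le_ofReal hC this

lemma lqNorm_congr_norm {𝕜' : Type*} [RCLike 𝕜'] {f : ℝ → 𝕜} {g : ℝ → 𝕜'} (q : ℝ≥0∞)
    (h : ∀ᵐ x ∂circleMeasure, ‖f x‖ = ‖g x‖) : lqNorm q f = lqNorm q g := by
  rw [lqNorm, lqNorm, eLpNorm_congr_norm_ae h]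

lemma lqNorm_add_le {f g : ℝ → 𝕜} {q : ℝ≥0∞} (hq : 1 ≤ q) (hf : MemLp f q circleMeasure)
    (hg : MemLp g q circleMeasure) : lqNorm q (fun x => f x + g x) ≤ lqNorm q f + lqNorm q g := by
  rw [lqNorm, lqNorm, lqNorm, ← ENNReal.toReal_add hf.2.ne hg.2.ne]
  exact ENNReal.toReal_mono (ENNReal.add_ne_top.2 ⟨hf.2.ne, hg.2.ne⟩) (eLpNorm_add_le hf.1 hg.1 hq)

lemma lqNorm_mono {𝕜' : Type*} [RCLike 𝕜'] {f : ℝ → 𝕜} {g : ℝ → 𝕜'} {q : ℝ≥0∞}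
    (hg : MemLp g q circleMeasure)
    (h : ∀ᵐ x ∂circleMeasure, ‖f x‖ ≤ ‖g x‖) : lqNorm q f ≤ lqNorm q g :=
  ENNReal.toReal_mono hg.2.ne (eLpNorm_mono_ae h)

lemma lqNorm_const_mul (c : 𝕜) (f : ℝ → 𝕜) (q : ℝ≥0∞) :
    lqNorm q (fun x => c * f x) = ‖c‖ * lqNorm q f := by
  have := eLpNorm_const_smul (p := q) (μ := circleMeasure) c f
  rw [lqNorm, lqNorm, show (fun x => c * f x) = c • f from rfl, this, ENNReal.toReal_mul]
  simp

lemma abs_lqNorm_sub_le {f g : ℝ → 𝕜} {q : ℝ≥0∞} (hq : 1 ≤ q) (hf : MemLp f q circleMeasure)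
    (hg : MemLp g q circleMeasure) :
    |lqNorm q f - lqNorm q g| ≤ lqNorm q (fun x => f x - g x) := by
  have h1 := lqNorm_add_le hq (hf.sub hg) hg
  have h2 := lqNorm_add_le hq (hg.sub hf) hf
  simp only [Pi.sub_apply, sub_add_cancel] at h1 h2
  have h3 : lqNorm q (fun x => g x - f x) = lqNorm q (fun x => f x - g x) :=
    lqNorm_congr_norm q (ae_of_all _ fun x => norm_sub_rev _ _)
  have h4 : lqNorm q (f - g) = lqNorm q (fun x => f x - g x) := rfl
  have h5 : lqNorm q (g - f) = lqNorm q (fun x => g x - f x) := rfl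
  rw [abs_le]
  constructor <;> linarith

lemma tendsto_lqNorm {F : ℕ → ℝ → 𝕜} {f : ℝ → 𝕜} {q : ℝ≥0∞} (hq : 1 ≤ q)
    (hF : ∀ n, MemLp (F n) q circleMeasure) (hf : MemLp f q circleMeasure)
    (h : Tendsto (fun n => lqNorm q (fun x => F n x - f x)) atTop (𝓝 0)) :
    Tendsto (fun n => lqNorm q (F n)) atTop (𝓝 (lqNorm q f)) := by
  rw [tendsto_iff_dist_tendsto_zero]
  exact squeeze_zero (fun _ => dist_nonneg) (fun n => abs_lqNorm_sub_le hq (hF n) hf) h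

lemma tendsto_lqNorm_of_uniform {F : ℕ → ℝ → 𝕜} {f : ℝ → 𝕜} {q : ℝ≥0∞} (hq : 1 ≤ q)
    (hF : ∀ n, MemLp (F n) q circleMeasure) (hf : MemLp f q circleMeasure) {ε : ℕ → ℝ}
    (hε : Tendsto ε atTop (𝓝 0)) (h : ∀ n, ∀ x ∈ Ioc 0 (2 * Real.pi), ‖F n x - f x‖ ≤ ε n) :
    Tendsto (fun n => lqNorm q (F n)) atTop (𝓝 (lqNorm q f)) := by
  refine tendsto_lqNorm hq hF hf (squeeze_zero (fun _ => lqNorm_nonneg _ _) (fun n => ?_) hε)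
  refine lqNorm_le_of_bound ?_ q (ae_circleMeasure_of_forall_Ioc (h n))
  exact (norm_nonneg _).trans (h n (2 * Real.pi) ⟨Real.two_pi_pos, le_rfl⟩)

lemma lqNorm_const (c : 𝕜) {q : ℝ≥0∞} (hq : q ≠ 0) : lqNorm q (fun _ => c) = ‖c‖ := by
  rw [lqNorm, eLpNorm_const c hq (IsProbabilityMeasure.ne_zero _)]
  simp

end Norm

/-! ### Continuously differentiable periodic functions -/

lemma memH1_of_contDiff {𝕜 : Type*} [RCLike 𝕜] {u : ℝ → 𝕜} (hu : ContDiff ℝ 1 u)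
    (hp : Function.Periodic u (2 * Real.pi)) : MemH1 u where
  periodic := hp
  absolutelyContinuous := hu.contDiffOn.absolutelyContinuousOnInterval
  memLp_deriv := memLp_of_continuous (hu.continuous_deriv le_rfl) 2

lemma MemH1.continuousOn {𝕜 : Type*} [RCLike 𝕜] {u : ℝ → 𝕜} (hu : MemH1 u) :
    ContinuousOn u (Icc 0 (2 * Real.pi)) := by
  have := hu.absolutelyContinuous.continuousOn
  rwa [uIcc_of_le Real.two_pi_pos.le] at this

lemma MemH1.memLp {𝕜 : Type*} [RCLike 𝕜] {u : ℝ → 𝕜} (hu : MemH1 u) (q : ℝ≥0∞) :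
    MemLp u q circleMeasure :=
  memLp_of_continuousOn hu.continuousOn q

lemma invNormInvSq_eq {u : ℝ → ℝ} (hu : Continuous u) (h0 : ∀ x, u x ≠ 0) :
    invNormInvSq u = (∫ x, (u x ^ 2)⁻¹ ∂circleMeasure)⁻¹ := by
  have hc : Continuous fun x => (u x ^ 2)⁻¹ :=
    (hu.pow 2).inv₀ fun x => pow_ne_zero 2 (h0 x)
  rw [invNormInvSq, ENNReal.toReal_inv, integral_eq_lintegral_of_nonneg_ae
    (ae_of_all _ fun x => by positivity) hc.aestronglyMeasurable]
  congr 3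
  funext x
  rw [ENNReal.ofReal_inv_of_pos (by have := h0 x; positivity)]

/-- Periodic functions inherit pointwise bounds from one period. -/
lemma exists_mem_Ioc_eq {E : Type*} {u : ℝ → E} (hp : Function.Periodic u (2 * Real.pi)) (x : ℝ) :
    ∃ y ∈ Ioc 0 (2 * Real.pi), u x = u y := by
  obtain ⟨y, hy, h⟩ := hp.exists_mem_Ioc Real.two_pi_pos x 0
  exact ⟨y, by simpa using hy, h⟩

/-! ### Wirtinger type inequalities -/

/-- A Riccati argument: `h = ω tan(ω(x - c))`, with `c` the midpoint, solves `h' = ω² + h²`. Hence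
`ω² f² - f'² = (h f²)' - (f' + h f)²`, and the exact derivative integrates to zero by the Dirichlet
conditions. Strictness of `ω < π / L` keeps the tangent continuous up to both endpoints. -/
lemma integral_sq_le_of_lt {f f' : ℝ → ℝ} (hf : ∀ x, HasDerivAt f (f' x) x) (hf' : Continuous f')
    {α L ω : ℝ} (hL : 0 < L) (h0 : f α = 0) (h1 : f (α + L) = 0) (hω : 0 < ω)
    (hωL : ω < Real.pi / L) :
    ω ^ 2 * ∫ x in α..α + L, f x ^ 2 ≤ ∫ x in α..α + L, f' x ^ 2 := by
  have hfc : Continuous f := continuous_iff_continuousAt.2 fun x => (hf x).continuousAt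
  set c : ℝ := α + L / 2 with hc
  have hcos : ∀ x ∈ Icc α (α + L), Real.cos (ω * (x - c)) ≠ 0 := by
    intro x hx
    have hb : ω * L < Real.pi := by rwa [lt_div_iff₀ hL] at hωL
    refine (Real.cos_pos_of_mem_Ioo ⟨?_, ?_⟩).ne' <;> nlinarith [hx.1, hx.2]
  have huIcc : uIcc α (α + L) = Icc α (α + L) := uIcc_of_le (by linarith)
  set h : ℝ → ℝ := fun x => ω * Real.tan (ω * (x - c)) with hh
  have hcont : ContinuousOn h (Icc α (α + L)) := by
    refine continuousOn_const.mul fun x hx => ?_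
    refine ContinuousAt.continuousWithinAt ?_
    exact ContinuousAt.comp (f := fun x => ω * (x - c))
      (Real.continuousAt_tan.2 (hcos x hx)) (by fun_prop)
  set G' : ℝ → ℝ := fun x => (ω ^ 2 + h x ^ 2) * f x ^ 2 + 2 * h x * f x * f' x with hG'
  have hG : ∀ x ∈ uIcc α (α + L), HasDerivAt (fun x => h x * f x ^ 2) (G' x) x := by
    intro x hx
    rw [huIcc] at hx
    have hx' := hcos x hx
    have e1 : HasDerivAt (fun x => ω * (x - c)) ω x := by
      simpa using ((hasDerivAt_id x).sub_const c).const_mul ω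
    have e2 := ((Real.hasDerivAt_tan hx').comp x e1).const_mul ω
    refine (e2.mul ((hf x).pow 2)).congr_deriv ?_
    have hs := Real.sin_sq_add_cos_sq (ω * (x - c))
    simp only [hG', hh, Real.tan_eq_sin_div_cos, Function.comp, Pi.pow_apply]
    field_simp
    linear_combination (-(ω * f x ^ 2)) * hs
  have hGc : ContinuousOn G' (uIcc α (α + L)) := by
    rw [huIcc]
    have := hfc.continuousOn (s := Icc α (α + L))
    have := hf'.continuousOn (s := Icc α (α + L))
    fun_prop
  have hint := intervalIntegral.integral_eq_sub_of_hasDerivAt hG hGc.intervalIntegrable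
  simp only [h0, h1] at hint
  have hle : ∫ x in α..α + L, (ω ^ 2 * f x ^ 2 - f' x ^ 2) ≤ ∫ x in α..α + L, G' x := by
    refine intervalIntegral.integral_mono_on (by linarith) ?_ hGc.intervalIntegrable ?_
    · exact (by fun_prop : Continuous _).intervalIntegrable _ _
    · intro x _
      have := sq_nonneg (f' x + h x * f x)
      simp only [hG']
      nlinarith
  rw [intervalIntegral.integral_sub ((by fun_prop : Continuous _).intervalIntegrable _ _)
    ((by fun_prop : Continuous _).intervalIntegrable _ _),
    intervalIntegral.integral_const_mul] at hle
  linarith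

/-- Wirtinger's inequality with Dirichlet conditions. -/
lemma integral_sq_le_of_zero {f f' : ℝ → ℝ} (hf : ∀ x, HasDerivAt f (f' x) x)
    (hf' : Continuous f') {α L : ℝ} (hL : 0 < L) (h0 : f α = 0) (h1 : f (α + L) = 0) :
    (Real.pi / L) ^ 2 * ∫ x in α..α + L, f x ^ 2 ≤ ∫ x in α..α + L, f' x ^ 2 := by
  have hpos : 0 < Real.pi / L := div_pos Real.pi_pos hL
  refine le_of_tendsto (f := fun ω : ℝ => ω ^ 2 * ∫ x in α..α + L, f x ^ 2)
    (x := 𝓝[<] (Real.pi / L)) ?_ ?_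
  · exact ((continuous_pow 2).mul continuous_const).continuousAt.continuousWithinAt.tendsto
  · filter_upwards [Ioo_mem_nhdsLT hpos] with ω hω
    exact integral_sq_le_of_lt hf hf' hL h0 h1 hω.1 hω.2

lemma deriv_shift {f f' : ℝ → ℝ} (hf : ∀ x, HasDerivAt f (f' x) x) (L x : ℝ) :
    HasDerivAt (fun x => f (x + L)) (f' (x + L)) x := by
  simpa using (hf (x + L)).comp_add_const x L

/-- Wirtinger's inequality for antiperiodic functions. -/
lemma integral_sq_le_of_antiperiodic {f f' : ℝ → ℝ} (hf : ∀ x, HasDerivAt f (f' x) x)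
    (hf' : Continuous f') {L : ℝ} (hL : 0 < L) (ha : Function.Antiperiodic f L) :
    (Real.pi / L) ^ 2 * ∫ x in 0..L, f x ^ 2 ≤ ∫ x in 0..L, f' x ^ 2 := by
  have hfc : Continuous f := continuous_iff_continuousAt.2 fun x => (hf x).continuousAt
  have ha' : Function.Antiperiodic f' L := fun x => by
    have h1 := deriv_shift hf L x
    rw [show (fun x => f (x + L)) = fun x => - f x from funext ha] at h1
    exact h1.unique (hf x).neg
  obtain ⟨x₀, hx₀⟩ : ∃ x, f x = 0 := by
    -- An antiperiodic function changes sign, so it has a zero, and the next one comes `L` later.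
    -- Periodicity of the squares then moves the Dirichlet inequality back to `[0, L]`.
    have h0 : f L = - f 0 := by simpa using ha 0
    rcases le_total (f 0) 0 with h | h
    · obtain ⟨x, _, hx⟩ := intermediate_value_Icc hL.le hfc.continuousOn
        (show (0 : ℝ) ∈ Icc (f 0) (f L) from ⟨h, by linarith⟩)
      exact ⟨x, hx⟩
    · obtain ⟨x, _, hx⟩ := intermediate_value_Icc' hL.le hfc.continuousOn
        (show (0 : ℝ) ∈ Icc (f L) (f 0) from ⟨by linarith, h⟩)
      exact ⟨x, hx⟩
  have hp : Function.Periodic (fun x => f x ^ 2) L := fun x => by simp [ha x]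
  have hp' : Function.Periodic (fun x => f' x ^ 2) L := fun x => by simp [ha' x]
  have := integral_sq_le_of_zero hf hf' hL hx₀ (by rw [ha x₀, hx₀, neg_zero])
  rw [hp.intervalIntegral_add_eq x₀ 0, hp'.intervalIntegral_add_eq x₀ 0, zero_add] at this
  exact this

/-- Wirtinger's inequality for periodic functions of zero mean. -/
lemma integral_sq_le_of_periodic {g g' : ℝ → ℝ} (hg : ∀ x, HasDerivAt g (g' x) x)
    (hg' : Continuous g') (hp : Function.Periodic g (2 * Real.pi))
    (h0 : ∫ x, g x ∂circleMeasure = 0) :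
    ∫ x, g x ^ 2 ∂circleMeasure ≤ ∫ x, g' x ^ 2 ∂circleMeasure := by
  have hgc : Continuous g := continuous_iff_continuousAt.2 fun x => (hg x).continuousAt
  have hp' : Function.Periodic g' (2 * Real.pi) := fun x => by
    have h1 := deriv_shift hg (2 * Real.pi) x
    rw [show (fun x => g (x + 2 * Real.pi)) = g from funext hp] at h1
    exact h1.unique (hg x)
  -- The difference `g (x + π) - g x` takes opposite values at `0` and `π`. Thus `g - g x₀` vanishes
  -- at `x₀`, `x₀ + π` and `x₀ + 2π`, and the Dirichlet inequality on two intervals of length `π`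
  -- has constant `1`.
  obtain ⟨x₀, hx₀⟩ : ∃ x, g (x + Real.pi) = g x := by
    have h2 : g (Real.pi + Real.pi) = g 0 := by have := hp 0; rw [zero_add, two_mul] at this; exact this
    have hc : Continuous fun x => g (x + Real.pi) - g x := by fun_prop
    rcases le_total (g Real.pi) (g 0) with h | h
    · obtain ⟨x, _, hx⟩ := intermediate_value_Icc Real.pi_pos.le hc.continuousOn
        (show (0 : ℝ) ∈ Icc _ _ from ⟨by simpa using h, by simpa [h2] using h⟩)
      exact ⟨x, sub_eq_zero.1 hx⟩
    · obtain ⟨x, _, hx⟩ := intermediate_value_Icc' Real.pi_pos.le hc.continuousOn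
        (show (0 : ℝ) ∈ Icc _ _ from ⟨by simpa [h2] using h, by simpa using h⟩)
      exact ⟨x, sub_eq_zero.1 hx⟩
  have hd : ∀ x, HasDerivAt (fun x => g x - g x₀) (g' x) x := fun x => (hg x).sub_const _
  have h1 := integral_sq_le_of_zero hd hg' Real.pi_pos (α := x₀) (by simp) (by simp [hx₀])
  have h2 := integral_sq_le_of_zero hd hg' Real.pi_pos (α := x₀ + Real.pi) (by simp [hx₀])
    (by rw [add_assoc, ← two_mul, hp x₀, sub_self])
  have hi : ∀ a b : ℝ, IntervalIntegrable (fun x => (g x - g x₀) ^ 2) volume a b := fun a b =>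
    (by fun_prop : Continuous _).intervalIntegrable _ _
  have hi' : ∀ a b : ℝ, IntervalIntegrable (fun x => g' x ^ 2) volume a b := fun a b =>
    (by fun_prop : Continuous _).intervalIntegrable _ _
  have h3 : ∫ x in (0 : ℝ)..2 * Real.pi, (g x - g x₀) ^ 2 ≤ ∫ x in (0 : ℝ)..2 * Real.pi, g' x ^ 2 := by
    have q1 : Function.Periodic (fun x => (g x - g x₀) ^ 2) (2 * Real.pi) := fun x => by simp [hp x]
    have q2 : Function.Periodic (fun x => g' x ^ 2) (2 * Real.pi) := fun x => by simp [hp' x]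
    have e1 := q1.intervalIntegral_add_eq 0 x₀
    have e2 := q2.intervalIntegral_add_eq 0 x₀
    rw [zero_add] at e1 e2
    rw [e1, e2, two_mul, ← add_assoc,
      ← intervalIntegral.integral_add_adjacent_intervals (hi x₀ (x₀ + Real.pi)) (hi _ _),
      ← intervalIntegral.integral_add_adjacent_intervals (hi' x₀ (x₀ + Real.pi)) (hi' _ _)]
    rw [div_self Real.pi_ne_zero] at h1 h2
    linarith
  have h4 : ∫ x, (g x - g x₀) ^ 2 ∂circleMeasure ≤ ∫ x, g' x ^ 2 ∂circleMeasure := by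
    rw [integral_circleMeasure, integral_circleMeasure]
    exact mul_le_mul_of_nonneg_left h3 (by positivity)
  refine le_trans ?_ h4
  -- With zero mean, subtracting `g x₀` can only increase the integral of the square, by `g x₀ ^ 2`.
  have h5 : ∫ x, (g x - g x₀) ^ 2 ∂circleMeasure
      = ∫ x, (g x ^ 2 - 2 * g x₀ * g x + g x₀ ^ 2) ∂circleMeasure :=
    integral_congr_ae (ae_of_all _ fun x => by ring)
  rw [h5, integral_add (integrable_of_continuous (by fun_prop)) (integrable_const _),
    integral_sub (integrable_of_continuous (by fun_prop)) (integrable_of_continuous (by fun_prop)),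
    integral_const_mul, h0]
  simp
  positivity

/-! ### Positive smooth functions and the critical inequality. -/

/-- Positive continuously differentiable functions on the circle. -/
structure IsSmoothPos (u : ℝ → ℝ) : Prop where
  contDiff : ContDiff ℝ 1 u
  periodic : Function.Periodic u (2 * Real.pi)
  pos : ∀ x, 0 < u x

namespace IsSmoothPos

variable {u : ℝ → ℝ} (hu : IsSmoothPos u)
include hu

lemma memH1 : MemH1 u := memH1_of_contDiff hu.contDiff hu.periodic

lemma hasDerivAt (x : ℝ) : HasDerivAt u (deriv u x) x :=
  (hu.contDiff.differentiable (by norm_num) x).hasDerivAt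

lemma continuous : Continuous u := hu.contDiff.continuous

lemma continuous_deriv : Continuous (deriv u) := hu.contDiff.continuous_deriv le_rfl

lemma continuous_inv_sq : Continuous fun x => (u x ^ 2)⁻¹ :=
  (hu.continuous.pow 2).inv₀ fun x => pow_ne_zero 2 (hu.pos x).ne'

lemma integral_inv_sq_pos : 0 < ∫ x, (u x ^ 2)⁻¹ ∂circleMeasure := by
  rw [integral_pos_iff_support_of_nonneg (fun x => by have := hu.pos x; positivity)
    (integrable_of_continuous hu.continuous_inv_sq)]
  have : Function.support (fun x => (u x ^ 2)⁻¹) = univ :=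
    Set.eq_univ_of_forall fun x => by have := hu.pos x; simp; positivity
  rw [this, measure_univ]
  exact one_pos

lemma invNormInvSq_eq : invNormInvSq u = (∫ x, (u x ^ 2)⁻¹ ∂circleMeasure)⁻¹ :=
  MagneticRing.invNormInvSq_eq hu.continuous fun x => (hu.pos x).ne'

lemma lqNorm_two_sq : lqNorm 2 u ^ 2 = ∫ x, u x ^ 2 ∂circleMeasure := by
  rw [MagneticRing.lqNorm_two_sq (hu.memH1.memLp 2)]; simp

lemma lqNorm_deriv_sq : lqNorm 2 (deriv u) ^ 2 = ∫ x, deriv u x ^ 2 ∂circleMeasure := by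
  rw [MagneticRing.lqNorm_two_sq hu.memH1.memLp_deriv]; simp

/-- The primitive of `u⁻²`. -/
lemma hasDerivAt_primitive (x : ℝ) :
    HasDerivAt (fun x => ∫ t in (0 : ℝ)..x, (u t ^ 2)⁻¹) ((u x ^ 2)⁻¹) x :=
  intervalIntegral.integral_hasDerivAt_right (hu.continuous_inv_sq.intervalIntegrable _ _)
    hu.continuous_inv_sq.stronglyMeasurable.stronglyMeasurableAtFilter
    hu.continuous_inv_sq.continuousAt

lemma primitive_add_period (x : ℝ) :
    ∫ t in (0 : ℝ)..x + 2 * Real.pi, (u t ^ 2)⁻¹ =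
      (∫ t in (0 : ℝ)..x, (u t ^ 2)⁻¹) + 2 * Real.pi * ∫ x, (u x ^ 2)⁻¹ ∂circleMeasure := by
  have hp : Function.Periodic (fun t => (u t ^ 2)⁻¹) (2 * Real.pi) := fun x => by simp [hu.periodic x]
  rw [integral_circleMeasure, smul_eq_mul, mul_inv_cancel_left₀ Real.two_pi_pos.ne',
    ← intervalIntegral.integral_add_adjacent_intervals
      (hu.continuous_inv_sq.intervalIntegrable 0 x) (hu.continuous_inv_sq.intervalIntegrable _ _),
    hp.intervalIntegral_add_eq x 0, zero_add]

/-- The critical inequality `‖u‖₂² ≤ 4 ‖u'‖₂² + ‖u⁻¹‖₂⁻²`. -/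
lemma critical_inequality :
    lqNorm 2 u ^ 2 ≤ 4 * lqNorm 2 (deriv u) ^ 2 + invNormInvSq u := by
  have hd := hu.hasDerivAt
  have hc := hu.continuous
  have hc' := hu.continuous_deriv
  have hV := hu.integral_inv_sq_pos
  set V := ∫ x, (u x ^ 2)⁻¹ ∂circleMeasure with hVdef
  -- The factor `(2V)⁻¹` makes `φ` gain exactly `π` per period, so `u cos φ` and `u sin φ` are
  -- antiperiodic. Their squared derivatives sum to `u'² + u² φ'²`, and `u² φ'²` has mean `(4V)⁻¹`.
  set φ : ℝ → ℝ := fun x => (2 * V)⁻¹ * ∫ t in (0 : ℝ)..x, (u t ^ 2)⁻¹ with hφ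
  have hφd : ∀ x, HasDerivAt φ ((2 * V)⁻¹ * (u x ^ 2)⁻¹) x := fun x =>
    (hu.hasDerivAt_primitive x).const_mul _
  have hφc : Continuous φ := continuous_iff_continuousAt.2 fun x => (hφd x).continuousAt
  have hφp : ∀ x, φ (x + 2 * Real.pi) = φ x + Real.pi := fun x => by
    simp only [hφ]
    rw [hu.primitive_add_period x, ← hVdef]
    field_simp
  have hinv := hu.continuous_inv_sq
  have A := integral_sq_le_of_antiperiodic (f := fun x => u x * Real.cos (φ x))
    (fun x => (hd x).mul (hφd x).cos) (by fun_prop) Real.two_pi_pos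
    (fun x => by simp [hφp, hu.periodic x, Real.cos_add_pi])
  have B := integral_sq_le_of_antiperiodic (f := fun x => u x * Real.sin (φ x))
    (fun x => (hd x).mul (hφd x).sin) (by fun_prop) Real.two_pi_pos
    (fun x => by simp [hφp, hu.periodic x, Real.sin_add_pi])
  have e : (Real.pi / (2 * Real.pi)) ^ 2 = 1 / 4 := by field_simp; norm_num
  rw [e] at A B
  have I : ∀ f : ℝ → ℝ, ∫ x in (0 : ℝ)..2 * Real.pi, f x = 2 * Real.pi * ∫ x, f x ∂circleMeasure :=
    fun f => by
      rw [integral_circleMeasure, smul_eq_mul, mul_inv_cancel_left₀ Real.two_pi_pos.ne']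
  rw [I, I] at A B
  have hpi := Real.two_pi_pos
  have S := add_le_add A B
  have S' : 2 * Real.pi * (1 / 4 * ∫ x, u x ^ 2 ∂circleMeasure) ≤
      2 * Real.pi * ((∫ x, deriv u x ^ 2 ∂circleMeasure) + (4 * V)⁻¹) := by
    convert! S using 1
    · rw [← mul_add, ← mul_add, ← integral_add (integrable_of_continuous (by fun_prop))
        (integrable_of_continuous (by fun_prop)), mul_left_comm]
      congr 2
      refine integral_congr_ae (ae_of_all _ fun x => ?_)
      have := Real.sin_sq_add_cos_sq (φ x)
      linear_combination (- u x ^ 2) * this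
    · rw [← mul_add, ← integral_add (integrable_of_continuous (by fun_prop))
        (integrable_of_continuous (by fun_prop))]
      have : (4 * V)⁻¹ = ∫ x, (4 * V ^ 2)⁻¹ * (u x ^ 2)⁻¹ ∂circleMeasure := by
        rw [integral_const_mul, ← hVdef]; field_simp
      rw [this, ← integral_add (integrable_of_continuous (by fun_prop))
        (integrable_of_continuous (by fun_prop))]
      congr 1
      refine integral_congr_ae (ae_of_all _ fun x => ?_)
      have h1 := Real.sin_sq_add_cos_sq (φ x)
      have h2 := (hu.pos x).ne'
      simp only
      field_simp
      linear_combination (-(16 * V ^ 2 * u x ^ 2 * deriv u x ^ 2 + 4)) * h1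
  have := le_of_mul_le_mul_left S' hpi
  rw [hu.lqNorm_two_sq, hu.lqNorm_deriv_sq, hu.invNormInvSq_eq, ← hVdef]
  have e4 : (4 * V)⁻¹ = 1 / 4 * V⁻¹ := by rw [mul_inv]; norm_num
  rw [e4] at this
  linarith

end IsSmoothPos

/-! ### Phase reconstruction and winding numbers -/

lemma scalarEnergy_eq (a p μ : ℝ) {u : ℝ → ℝ} (hu : IsSmoothPos u) :
    scalarEnergy a p μ u = (∫ x, deriv u x ^ 2 ∂circleMeasure)
      + a ^ 2 * (∫ x, (u x ^ 2)⁻¹ ∂circleMeasure)⁻¹ + μ * lqNorm (ENNReal.ofReal p) u ^ 2 := by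
  rw [scalarEnergy, hu.lqNorm_deriv_sq, hu.invNormInvSq_eq]

lemma magneticEnergy_eq (a p μ : ℝ) {ψ : ℝ → ℂ} (hψ : ContDiff ℝ 1 ψ) :
    magneticEnergy a p μ ψ =
      (∫ x, ‖deriv ψ x - Complex.I * (a : ℂ) * ψ x‖ ^ 2 ∂circleMeasure)
        + μ * lqNorm (ENNReal.ofReal p) (fun x => ‖ψ x‖) ^ 2 := by
  have h1 := hψ.continuous
  have h2 := hψ.continuous_deriv le_rfl
  rw [magneticEnergy, lqNorm_two_sq (memLp_of_continuous (by fun_prop) 2)]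
  congr 3
  exact lqNorm_congr_norm _ (ae_of_all _ fun x => by simp)

/-- The phase minimising the energy among those of winding number zero satisfies `φ' = a - (a/V)
u⁻²`, where `V` is the mean of `u⁻²`. It is periodic because the right-hand side has zero mean, and
`u² (φ' - a)² = (a/V)² u⁻²` has mean `a² V⁻¹`. -/
lemma IsSmoothPos.exists_magneticEnergy_eq {u : ℝ → ℝ} (hu : IsSmoothPos u) (a p μ : ℝ) :
    ∃ ψ : ℝ → ℂ, MemH1 ψ ∧ (∀ x, ‖ψ x‖ = u x) ∧
      magneticEnergy a p μ ψ = scalarEnergy a p μ u := by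
  have hV := hu.integral_inv_sq_pos
  set V := ∫ x, (u x ^ 2)⁻¹ ∂circleMeasure with hVdef
  have hinv := hu.continuous_inv_sq
  have hc := hu.continuous
  have hc' := hu.continuous_deriv
  set φ : ℝ → ℝ := fun x => a * x - a / V * ∫ t in (0 : ℝ)..x, (u t ^ 2)⁻¹ with hφ
  have hφd : ∀ x, HasDerivAt φ (a - a / V * (u x ^ 2)⁻¹) x := fun x => by
    have h1 : HasDerivAt (fun x : ℝ => a * x) a x := by simpa using (hasDerivAt_id x).const_mul a
    exact h1.sub ((hu.hasDerivAt_primitive x).const_mul _)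
  have hφp : Function.Periodic φ (2 * Real.pi) := fun x => by
    simp only [hφ]
    rw [hu.primitive_add_period x, ← hVdef]
    field_simp
    ring
  have hφc : ContDiff ℝ 1 φ := by
    rw [contDiff_one_iff_deriv]
    refine ⟨fun x => (hφd x).differentiableAt, ?_⟩
    rw [show deriv φ = fun x => a - a / V * (u x ^ 2)⁻¹ from funext fun x => (hφd x).deriv]
    fun_prop
  set ψ : ℝ → ℂ := fun x => (u x : ℂ) * Complex.exp ((φ x : ℂ) * Complex.I) with hψ
  have hψd : ∀ x, HasDerivAt ψ (((deriv u x : ℝ) : ℂ) * Complex.exp ((φ x : ℂ) * Complex.I)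
      + (u x : ℂ) * (Complex.exp ((φ x : ℂ) * Complex.I) *
        (((a - a / V * (u x ^ 2)⁻¹ : ℝ) : ℂ) * Complex.I))) x := fun x => by
    have h1 : HasDerivAt (fun x => (u x : ℂ)) ((deriv u x : ℝ) : ℂ) x := (hu.hasDerivAt x).ofReal_comp
    have h2 : HasDerivAt (fun x => (φ x : ℂ)) ((a - a / V * (u x ^ 2)⁻¹ : ℝ) : ℂ) x :=
      (hφd x).ofReal_comp
    exact h1.mul (h2.mul_const Complex.I).cexp
  have hψc : ContDiff ℝ 1 ψ :=
    (Complex.ofRealCLM.contDiff.comp hu.contDiff).mul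
      (((Complex.ofRealCLM.contDiff.comp hφc).mul contDiff_const).cexp)
  have hnorm : ∀ x, ‖ψ x‖ = u x := fun x => by
    simp only [hψ]
    rw [norm_mul, Complex.norm_exp_ofReal_mul_I, mul_one, Complex.norm_real, Real.norm_eq_abs,
      abs_of_pos (hu.pos x)]
  refine ⟨ψ, memH1_of_contDiff hψc fun x => by simp [hψ, hφp x, hu.periodic x], hnorm, ?_⟩
  rw [magneticEnergy_eq _ _ _ hψc, scalarEnergy_eq _ _ _ hu]
  congr 1
  · have e : a ^ 2 * (∫ x, (u x ^ 2)⁻¹ ∂circleMeasure)⁻¹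
        = ∫ x, (a / V) ^ 2 * (u x ^ 2)⁻¹ ∂circleMeasure := by
      rw [integral_const_mul, ← hVdef]; field_simp
    rw [e, ← integral_add (integrable_of_continuous (by fun_prop))
      (integrable_of_continuous (by fun_prop))]
    refine integral_congr_ae (ae_of_all _ fun x => ?_)
    have h0 := (hu.pos x).ne'
    have e2 : deriv ψ x - Complex.I * (a : ℂ) * ψ x =
        (((deriv u x : ℝ) : ℂ) + ((-(a / V * (u x)⁻¹) : ℝ) : ℂ) * Complex.I)
          * Complex.exp ((φ x : ℂ) * Complex.I) := by
      have h0' : (u x : ℂ) ≠ 0 := by exact_mod_cast h0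
      rw [(hψd x).deriv]
      simp only [hψ]
      push_cast
      field_simp
      ring
    simp only
    rw [e2, norm_mul, Complex.norm_exp_ofReal_mul_I, mul_one, ← Complex.normSq_eq_norm_sq,
      Complex.normSq_add_mul_I]
    field_simp
  · rw [show (fun x => ‖ψ x‖) = u from funext hnorm]

/-- Diamagnetic inequality with winding number: a non-vanishing function has at least the energy
of its modulus. -/
lemma scalarEnergy_norm_le {ψ : ℝ → ℂ} (hψ : ContDiff ℝ 1 ψ)
    (hp : Function.Periodic ψ (2 * Real.pi)) (h0 : ∀ x, ψ x ≠ 0) {a : ℝ} (ha₀ : 0 < a)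
    (ha₁ : a < 1 / 2) (p μ : ℝ) :
    IsSmoothPos (fun x => ‖ψ x‖) ∧
      scalarEnergy a p μ (fun x => ‖ψ x‖) ≤ magneticEnergy a p μ ψ := by
  have hu : IsSmoothPos (fun x => ‖ψ x‖) :=
    ⟨hψ.norm ℝ h0, fun x => by simp [hp x], fun x => norm_pos_iff.2 (h0 x)⟩
  refine ⟨hu, ?_⟩
  have hcψ := hψ.continuous
  have hcψ' := hψ.continuous_deriv le_rfl
  have hdψ : ∀ x, HasDerivAt ψ (deriv ψ x) x := fun x =>
    (hψ.differentiable (by norm_num) x).hasDerivAt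
  -- The logarithmic derivative carries both polar parts without choosing an argument: `Re w` is the
  -- derivative of `log ‖ψ‖`, and `Im w` is the angular speed, whose mean is the winding number `k`.
  set w : ℝ → ℂ := fun x => deriv ψ x / ψ x with hw
  have hcw : Continuous w := hcψ'.div hcψ h0
  set W : ℝ → ℂ := fun x => ∫ t in (0 : ℝ)..x, w t with hW
  have hWd : ∀ x, HasDerivAt W (w x) x := fun x =>
    intervalIntegral.integral_hasDerivAt_right (hcw.intervalIntegrable _ _)
      hcw.stronglyMeasurable.stronglyMeasurableAtFilter hcw.continuousAt
  have hψW : ∀ x, ψ x = ψ 0 * Complex.exp (W x) := by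
    have hd : ∀ x, HasDerivAt (fun x => ψ x * Complex.exp (-W x)) 0 x := fun x => by
      refine ((hdψ x).mul (hWd x).neg.cexp).congr_deriv ?_
      have := h0 x
      simp only [hw]
      field_simp
      ring
    intro x
    have h1 := is_const_of_deriv_eq_zero (fun x => (hd x).differentiableAt)
      (fun x => (hd x).deriv) x 0
    simp only [hW, intervalIntegral.integral_same, neg_zero, Complex.exp_zero, mul_one] at h1
    rw [← h1, mul_assoc, ← Complex.exp_add]
    simp [hW]
  obtain ⟨k, hk⟩ : ∃ k : ℤ, W (2 * Real.pi) = k * (2 * Real.pi * Complex.I) := by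
    rw [← Complex.exp_eq_one_iff]
    have h1 := hψW (2 * Real.pi)
    have h2 := hp 0
    rw [zero_add] at h2
    rw [h2] at h1
    exact mul_left_cancel₀ (h0 0) (by rw [← h1, mul_one])
  have hmean : ∫ x, ((w x).im - a) ∂circleMeasure = k - a := by
    have e : ∫ x, w x ∂circleMeasure = k * Complex.I := by
      rw [integral_circleMeasure, show (∫ x in (0 : ℝ)..2 * Real.pi, w x) = W (2 * Real.pi) from rfl,
        hk, Complex.real_smul]
      have : (Real.pi : ℂ) ≠ 0 := by exact_mod_cast Real.pi_ne_zero
      push_cast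
      field_simp
    have e2 := integral_im (𝕜 := ℂ) (integrable_of_continuous hcw)
    rw [e] at e2
    rw [integral_sub (integrable_of_continuous (by fun_prop)) (integrable_const _)]
    simp only [RCLike.im_to_complex] at e2
    rw [e2]
    simp
  have hud : ∀ x, deriv (fun x => ‖ψ x‖) x = (w x).re * ‖ψ x‖ := fun x => by
    have h1 : (fun x => ‖ψ x‖) = fun x => ‖ψ 0‖ * Real.exp (W x).re := by
      funext y
      rw [hψW y, norm_mul, Complex.norm_exp]
    have h2 : HasDerivAt (fun x => (W x).re) (w x).re x :=
      Complex.reCLM.hasFDerivAt.comp_hasDerivAt x (hWd x)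
    have h3 := (h2.exp.const_mul ‖ψ 0‖)
    rw [h1, h3.deriv, hψW x, norm_mul, Complex.norm_exp]
    ring
  have hV := hu.integral_inv_sq_pos
  have hinv := hu.continuous_inv_sq
  set V := ∫ x, (‖ψ x‖ ^ 2)⁻¹ ∂circleMeasure with hVdef
  rw [magneticEnergy_eq _ _ _ hψ, scalarEnergy_eq _ _ _ hu, ← hVdef]
  have hin : Continuous fun x => ‖ψ x‖ := hcψ.norm
  have hS : ∫ x, ‖deriv ψ x - Complex.I * (a : ℂ) * ψ x‖ ^ 2 ∂circleMeasure =
      (∫ x, deriv (fun x => ‖ψ x‖) x ^ 2 ∂circleMeasure) +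
        ∫ x, ((w x).im - a) ^ 2 * ‖ψ x‖ ^ 2 ∂circleMeasure := by
    have hcd : Continuous fun x => deriv (fun x => ‖ψ x‖) x ^ 2 := hu.continuous_deriv.pow 2
    have hcb : Continuous fun x => ((w x).im - a) ^ 2 * ‖ψ x‖ ^ 2 := by fun_prop
    rw [← integral_add (integrable_of_continuous hcd) (integrable_of_continuous hcb)]
    refine integral_congr_ae (ae_of_all _ fun x => ?_)
    have e : deriv ψ x - Complex.I * (a : ℂ) * ψ x =
        (((w x).re : ℂ) + (((w x).im - a : ℝ) : ℂ) * Complex.I) * ψ x := by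
      have h1 : deriv ψ x = w x * ψ x := by simp only [hw]; field_simp [h0 x]
      rw [h1]
      conv_lhs => rw [← Complex.re_add_im (w x)]
      push_cast
      ring
    simp only
    rw [hud x, e, norm_mul, mul_pow, ← Complex.normSq_eq_norm_sq (_ + _),
      Complex.normSq_add_mul_I]
    ring
  have hB : a ^ 2 * V⁻¹ ≤ ∫ x, ((w x).im - a) ^ 2 * ‖ψ x‖ ^ 2 ∂circleMeasure := by
    set m : ℝ := k - a with hm
    -- Here `a < 1/2` enters: `0` is the integer nearest to `a`.
    have hm2 : a ^ 2 ≤ m ^ 2 := by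
      rcases lt_trichotomy k 0 with h | h | h
      · have : (k : ℝ) ≤ -1 := by exact_mod_cast Int.le_sub_one_of_lt h
        nlinarith
      · simp [hm, h]
      · have : (1 : ℝ) ≤ k := by exact_mod_cast h
        nlinarith
    -- Cauchy–Schwarz for `(Im w - a)‖ψ‖` against `‖ψ‖⁻¹`, written as a square with the optimal
    -- multiplier `m / V`.
    have h1 : 0 ≤ ∫ x, (((w x).im - a) * ‖ψ x‖ - m / V * ‖ψ x‖⁻¹) ^ 2 ∂circleMeasure :=
      integral_nonneg fun x => sq_nonneg _
    have h2 : ∫ x, (((w x).im - a) * ‖ψ x‖ - m / V * ‖ψ x‖⁻¹) ^ 2 ∂circleMeasure =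
        ∫ x, (((w x).im - a) ^ 2 * ‖ψ x‖ ^ 2 - 2 * (m / V) * ((w x).im - a)
          + (m / V) ^ 2 * (‖ψ x‖ ^ 2)⁻¹) ∂circleMeasure := by
      refine integral_congr_ae (ae_of_all _ fun x => ?_)
      have := norm_pos_iff.2 (h0 x)
      simp only
      field_simp
      ring
    rw [h2, integral_add (integrable_of_continuous (by fun_prop))
      (integrable_of_continuous (by fun_prop)), integral_sub
      (integrable_of_continuous (by fun_prop)) (integrable_of_continuous (by fun_prop)),
      integral_const_mul, integral_const_mul, hmean, ← hVdef] at h1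
    have h3 : m ^ 2 * V⁻¹ = 2 * (m / V) * m - (m / V) ^ 2 * V := by field_simp; ring
    have h4 : a ^ 2 * V⁻¹ ≤ m ^ 2 * V⁻¹ :=
      mul_le_mul_of_nonneg_right hm2 (inv_nonneg.2 hV.le)
    linarith
  rw [hS]
  linarith

/-! ### Trigonometric polynomials and density -/

/-- The trigonometric polynomial `∑ k ∈ s, c k e^{ikx}`. -/
noncomputable def trigPoly (s : Finset ℤ) (c : ℤ → ℂ) (x : ℝ) : ℂ :=
  ∑ k ∈ s, c k * Complex.exp (k * x * Complex.I)

lemma hasDerivAt_trigPoly (s : Finset ℤ) (c : ℤ → ℂ) (x : ℝ) :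
    HasDerivAt (trigPoly s c) (trigPoly s (fun k => c k * (k * Complex.I)) x) x := by
  unfold trigPoly
  refine HasDerivAt.fun_sum fun k _ => ?_
  have h1 : HasDerivAt (fun x : ℝ => (k : ℂ) * x * Complex.I) (k * 1 * Complex.I) x :=
    (((hasDerivAt_id x).ofReal_comp).const_mul (k : ℂ)).mul_const Complex.I
  refine (h1.cexp.const_mul (c k)).congr_deriv ?_
  ring

lemma contDiff_trigPoly (s : Finset ℤ) (c : ℤ → ℂ) {n : WithTop ℕ∞} :
    ContDiff ℝ n (trigPoly s c) := by
  unfold trigPoly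
  refine ContDiff.sum fun k _ => contDiff_const.mul (ContDiff.cexp ?_)
  exact (contDiff_const.mul Complex.ofRealCLM.contDiff).mul contDiff_const

lemma continuous_trigPoly (s : Finset ℤ) (c : ℤ → ℂ) : Continuous (trigPoly s c) :=
  (contDiff_trigPoly s c (n := 0)).continuous

lemma periodic_trigPoly (s : Finset ℤ) (c : ℤ → ℂ) :
    Function.Periodic (trigPoly s c) (2 * Real.pi) := fun x => by
  unfold trigPoly
  refine Finset.sum_congr rfl fun k _ => ?_
  congr 1
  rw [Complex.exp_eq_exp_iff_exists_int]
  exact ⟨k, by push_cast; ring⟩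

/-- Transfers the `L²` density of the Fourier basis on `AddCircle` to periodic functions on the
line. -/
lemma measurePreserving_circle [Fact (0 < 2 * Real.pi)] :
    MeasurePreserving ((↑) : ℝ → AddCircle (2 * Real.pi)) circleMeasure
      AddCircle.haarAddCircle := by
  have h := AddCircle.measurePreserving_mk (2 * Real.pi) 0
  rw [zero_add] at h
  refine ⟨h.measurable, ?_⟩
  rw [circleMeasure, Measure.map_smul, h.map_eq, AddCircle.volume_eq_smul_haarAddCircle, smul_smul,
    ENNReal.inv_mul_cancel _ ENNReal.ofReal_ne_top, one_smul]
  simp [Real.pi_pos]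

/-- Trigonometric polynomials are dense in `L²`. -/
lemma exists_trigPoly_lqNorm_sub_le {g : ℝ → ℂ} (hg : MemLp g 2 circleMeasure) {ε : ℝ}
    (hε : 0 < ε) :
    ∃ (s : Finset ℤ) (c : ℤ → ℂ), lqNorm 2 (fun x => trigPoly s c x - g x) ≤ ε := by
  have : Fact (0 < 2 * Real.pi) := ⟨Real.two_pi_pos⟩
  have hg' : MemLp g 2 (volume.restrict (Ioc 0 (0 + 2 * Real.pi))) := by
    have h := hg.smul_measure (c := ENNReal.ofReal (2 * Real.pi)) ENNReal.ofReal_ne_top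
    rwa [circleMeasure, smul_smul, ENNReal.mul_inv_cancel (by simp [Real.pi_pos])
      ENNReal.ofReal_ne_top, one_smul, ← zero_add (2 * Real.pi)] at h
  have hG := hg'.memLp_liftIoc.haarAddCircle
  set G := AddCircle.liftIoc (2 * Real.pi) 0 g with hGdef
  have hmem : hG.toLp G ∈
      (Submodule.span ℂ (range (@fourierLp (2 * Real.pi) _ 2 _))).topologicalClosure := by
    rw [span_fourierLp_closure_eq_top (by norm_num)]; trivial
  obtain ⟨y, hy, hd⟩ := Metric.mem_closure_iff.1 hmem ε hε
  obtain ⟨c, rfl⟩ := Finsupp.mem_span_range_iff_exists_finsupp.1 hy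
  refine ⟨c.support, c, ?_⟩
  have hae : (c.sum fun i a => a • (@fourierLp (2 * Real.pi) _ 2 _) i : Lp ℂ 2 _)
      =ᵐ[AddCircle.haarAddCircle] fun x => ∑ k ∈ c.support, c k * fourier k x := by
    have e : (c.sum fun i a => a • (@fourierLp (2 * Real.pi) _ 2 _) i : Lp ℂ 2 _) =
        ContinuousMap.toLp (E := ℂ) 2 AddCircle.haarAddCircle ℂ
          (∑ k ∈ c.support, c k • fourier k) := by
      rw [map_sum]
      simp only [map_smul]
      rfl
    rw [e]
    filter_upwards [ContinuousMap.coeFn_toLp (p := 2) (𝕜 := ℂ) AddCircle.haarAddCircle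
      (∑ k ∈ c.support, c k • fourier k : C(AddCircle (2 * Real.pi), ℂ))] with x hx
    rw [hx, ContinuousMap.sum_apply]
    rfl
  have h1 : eLpNorm (fun x => (∑ k ∈ c.support, c k * fourier k x) - G x) 2
      AddCircle.haarAddCircle ≤ ENNReal.ofReal ε := by
    rw [dist_comm, Lp.dist_def] at hd
    refine le_trans (le_of_eq ?_) (ENNReal.ofReal_le_ofReal hd.le)
    rw [ENNReal.ofReal_toReal]
    · refine eLpNorm_congr_ae ?_
      filter_upwards [hae, hG.coeFn_toLp] with x h1 h2
      rw [Pi.sub_apply, h1, h2]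
    · exact ((Lp.memLp _).sub (Lp.memLp _)).2.ne
  have h2 := eLpNorm_comp_measurePreserving (p := 2) (ν := AddCircle.haarAddCircle)
    (g := fun x => (∑ k ∈ c.support, c k * fourier k x) - G x) ?_ measurePreserving_circle
  · refine ENNReal.toReal_le_of_le_ofReal hε.le ?_
    refine le_trans (le_of_eq ?_) h1
    rw [← h2]
    refine eLpNorm_congr_ae (ae_circleMeasure_of_forall_Ioc fun x hx => ?_)
    simp only [Function.comp, hGdef]
    rw [AddCircle.liftIoc_zero_coe_apply hx, trigPoly]
    congr 1
    refine Finset.sum_congr rfl fun k _ => ?_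
    rw [fourier_coe_apply]
    congr 2
    have : (Real.pi : ℂ) ≠ 0 := by exact_mod_cast Real.pi_ne_zero
    push_cast
    field_simp
  · refine AEStronglyMeasurable.sub ?_ hG.1
    exact (continuous_finsetSum _ fun k _ =>
      continuous_const.mul (map_continuous (fourier k))).aestronglyMeasurable


/-! ### Calculus in `H¹` and density of trigonometric polynomials. -/

lemma MemH1.comp_clm {ψ : ℝ → ℂ} (hψ : MemH1 ψ) (L : ℂ →L[ℝ] ℝ) :
    AbsolutelyContinuousOnInterval (fun x => L (ψ x)) 0 (2 * Real.pi) := by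
  have h := hψ.absolutelyContinuous
  unfold AbsolutelyContinuousOnInterval at h ⊢
  refine squeeze_zero (fun _ => Finset.sum_nonneg fun _ _ => dist_nonneg) (fun E => ?_)
    (by simpa using h.const_mul ‖L‖)
  rw [Finset.mul_sum]
  refine Finset.sum_le_sum fun i _ => ?_
  rw [dist_eq_norm, dist_eq_norm, ← map_sub]
  exact L.le_opNorm _

/-- The real and imaginary parts are real absolutely continuous functions, hence differentiable
almost everywhere, and `ψ` is recombined from them. -/
lemma MemH1.ae_hasDerivAt {ψ : ℝ → ℂ} (hψ : MemH1 ψ) :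
    ∀ᵐ x, x ∈ uIcc 0 (2 * Real.pi) → HasDerivAt ψ (deriv ψ x) x := by
  filter_upwards [(hψ.comp_clm Complex.reCLM).ae_differentiableAt,
    (hψ.comp_clm Complex.imCLM).ae_differentiableAt] with x h1 h2 hx
  have d1 := (h1 hx).hasDerivAt.ofReal_comp
  have d2 := (h2 hx).hasDerivAt.ofReal_comp
  have d3 := d1.add (d2.mul_const Complex.I)
  have e : ((fun y => ((Complex.reCLM (ψ y) : ℝ) : ℂ)) +
      fun y => ((Complex.imCLM (ψ y) : ℝ) : ℂ) * Complex.I) = ψ := by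
    funext y
    simp
  rw [e] at d3
  exact d3.differentiableAt.hasDerivAt

lemma MemH1.integrable_deriv {𝕜 : Type*} [RCLike 𝕜] {ψ : ℝ → 𝕜} (hψ : MemH1 ψ) :
    Integrable (deriv ψ) circleMeasure :=
  memLp_one_iff_integrable.1 (hψ.memLp_deriv.mono_exponent (by norm_num))

lemma integrableOn_of_integrable {E : Type*} [NormedAddCommGroup E] {f : ℝ → E}
    (hf : Integrable f circleMeasure) : IntegrableOn f (Ioc 0 (2 * Real.pi)) := by
  have h := hf.smul_measure (c := ENNReal.ofReal (2 * Real.pi)) ENNReal.ofReal_ne_top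
  rwa [circleMeasure, smul_smul, ENNReal.mul_inv_cancel (by simp [Real.pi_pos])
    ENNReal.ofReal_ne_top, one_smul] at h

lemma intervalIntegrable_of_integrable {E : Type*} [NormedAddCommGroup E] {f : ℝ → E}
    (hf : Integrable f circleMeasure) {x : ℝ} (hx : x ∈ Icc 0 (2 * Real.pi)) :
    IntervalIntegrable f volume 0 x := by
  rw [intervalIntegrable_iff_integrableOn_Ioc_of_le hx.1]
  exact (integrableOn_of_integrable hf).mono_set (Ioc_subset_Ioc_right hx.2)

/-- The fundamental theorem of calculus in `H¹`. -/
lemma MemH1.eq_add_integral {ψ : ℝ → ℂ} (hψ : MemH1 ψ) {x : ℝ} (hx : x ∈ Icc 0 (2 * Real.pi)) :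
    ψ x = ψ 0 + ∫ t in (0 : ℝ)..x, deriv ψ t := by
  have hint := intervalIntegrable_of_integrable hψ.integrable_deriv hx
  have hsub : uIcc 0 x ⊆ uIcc 0 (2 * Real.pi) := by
    rw [uIcc_of_le hx.1, uIcc_of_le Real.two_pi_pos.le]
    exact Icc_subset_Icc_right hx.2
  have key : ∀ L : ℂ →L[ℝ] ℝ, L (∫ t in (0 : ℝ)..x, deriv ψ t) = L (ψ x) - L (ψ 0) := fun L => by
    rw [← L.intervalIntegral_comp_comm hint,
      ← ((hψ.comp_clm L).mono hsub).integral_deriv_eq_sub]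
    refine intervalIntegral.integral_congr_ae ?_
    filter_upwards [hψ.ae_hasDerivAt] with t ht htx
    have := L.hasFDerivAt.comp_hasDerivAt t (ht (hsub (uIoc_subset_uIcc htx)))
    exact this.deriv.symm
  have h1 := key Complex.reCLM
  have h2 := key Complex.imCLM
  simp only [Complex.reCLM_apply, Complex.imCLM_apply] at h1 h2
  apply Complex.ext
  · rw [Complex.add_re, h1]; ring
  · rw [Complex.add_im, h2]; ring

lemma MemH1.integral_deriv_eq_zero {ψ : ℝ → ℂ} (hψ : MemH1 ψ) :
    ∫ x, deriv ψ x ∂circleMeasure = 0 := by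
  have h1 := hψ.eq_add_integral (right_mem_Icc.2 Real.two_pi_pos.le)
  have h2 := hψ.periodic 0
  rw [zero_add] at h2
  rw [h2, left_eq_add] at h1
  rw [integral_circleMeasure, h1, smul_zero]

lemma integral_norm_le_lqNorm {f : ℝ → ℂ} (hf : MemLp f 2 circleMeasure) :
    ∫ x, ‖f x‖ ∂circleMeasure ≤ lqNorm 2 f := by
  have h1 := eLpNorm_le_eLpNorm_of_exponent_le (μ := circleMeasure) (p := 1) (q := 2)
    (by norm_num) hf.1
  rw [integral_norm_eq_lintegral_enorm hf.1, ← eLpNorm_one_eq_lintegral_enorm]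
  exact ENNReal.toReal_mono hf.2.ne h1

/-- Trigonometric polynomials are dense in `H¹`. -/
lemma MemH1.exists_trigPoly {ψ : ℝ → ℂ} (hψ : MemH1 ψ) {ε : ℝ} (hε : 0 < ε) :
    ∃ (s : Finset ℤ) (c : ℤ → ℂ), (∀ x, ‖trigPoly s c x - ψ x‖ ≤ ε) ∧
      lqNorm 2 (fun x => deriv (trigPoly s c) x - deriv ψ x) ≤ ε := by
  have hpi := Real.pi_pos
  -- The derivative error will be at most `2δ` in `L²`, and its integral over a period at most
  -- `4πδ`. Both are bounded by `ε`.
  set δ := ε / (4 * Real.pi + 2) with hδ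
  have hδ0 : 0 < δ := by positivity
  obtain ⟨s, c, hsc⟩ := exists_trigPoly_lqNorm_sub_le hψ.memLp_deriv hδ0
  set b : ℂ := if 0 ∈ s then c 0 else 0 with hb
  -- `T` is the primitive of the approximation of `ψ'` with its zero mode `b` removed, since that
  -- mode has no periodic primitive. The free constant is fixed by `T 0 = ψ 0`.
  set d : ℤ → ℂ := fun k => if k = 0 then
    ψ 0 - ∑ k ∈ s.erase 0, c k / (k * Complex.I) else c k / (k * Complex.I) with hd
  set T := trigPoly (insert 0 (s.erase 0)) d with hT
  have hT0 : T 0 = ψ 0 := by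
    simp only [hT, trigPoly]
    rw [Finset.sum_insert (Finset.notMem_erase 0 s)]
    have : ∑ k ∈ s.erase 0, d k * Complex.exp (k * ((0 : ℝ) : ℂ) * Complex.I) =
        ∑ k ∈ s.erase 0, c k / (k * Complex.I) :=
      Finset.sum_congr rfl fun k hk => by simp [hd, (Finset.mem_erase.1 hk).1]
    rw [this]
    simp [hd]
  have hTd : ∀ x, HasDerivAt T (trigPoly s c x - b) x := fun x => by
    refine (hasDerivAt_trigPoly _ _ x).congr_deriv ?_
    have h1 : trigPoly s c x = b + ∑ k ∈ s.erase 0, c k * Complex.exp (k * x * Complex.I) := by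
      by_cases h : 0 ∈ s
      · rw [trigPoly, ← Finset.add_sum_erase s _ h, hb, if_pos h]
        simp
      · simp [trigPoly, hb, h]
    rw [h1, add_sub_cancel_left, trigPoly, Finset.sum_insert (Finset.notMem_erase 0 s)]
    simp only [Int.cast_zero, zero_mul, mul_zero, zero_add]
    refine Finset.sum_congr rfl fun k hk => ?_
    have hk0 := (Finset.mem_erase.1 hk).1
    have hk1 : (k : ℂ) ≠ 0 := by exact_mod_cast hk0
    simp only [hd, hk0, if_false]
    have := Complex.I_ne_zero
    field_simp
  have hTH : MemH1 T := memH1_of_contDiff (contDiff_trigPoly _ _) (periodic_trigPoly _ _)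
  have hTder : ∀ x, deriv T x = trigPoly s c x - b := fun x => (hTd x).deriv
  have hSL : MemLp (trigPoly s c) 2 circleMeasure := memLp_of_continuous (continuous_trigPoly _ _) 2
  have hSL1 : Integrable (trigPoly s c) circleMeasure :=
    integrable_of_continuous (continuous_trigPoly _ _)
  -- Removing `b` is cheap: `ψ'` has zero mean, so `b` is the mean of the approximation error.
  have hb_le : ‖b‖ ≤ δ := by
    have h1 : ∫ x, (trigPoly s c x - deriv ψ x) ∂circleMeasure = b := by
      have h2 := hTH.integral_deriv_eq_zero
      simp only [hTder] at h2
      rw [integral_sub hSL1 (integrable_const _)] at h2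
      rw [integral_sub hSL1 hψ.integrable_deriv, hψ.integral_deriv_eq_zero, sub_zero]
      simpa [sub_eq_zero] using h2
    rw [← h1]
    exact (norm_integral_le_integral_norm _).trans
      ((integral_norm_le_lqNorm (hSL.sub hψ.memLp_deriv)).trans hsc)
  have hL2 : lqNorm 2 (fun x => deriv T x - deriv ψ x) ≤ 2 * δ := by
    have e : (fun x => deriv T x - deriv ψ x) =
        fun x => (trigPoly s c x - deriv ψ x) + (fun _ => -b) x := by
      funext x
      rw [hTder]
      ring
    rw [e]
    refine (lqNorm_add_le (by norm_num) (hSL.sub hψ.memLp_deriv) (memLp_const _)).trans ?_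
    rw [lqNorm_const _ (by norm_num), norm_neg]
    have : lqNorm 2 (trigPoly s c - deriv ψ) ≤ δ := hsc
    linarith
  have hdiff : MemLp (fun x => deriv T x - deriv ψ x) 2 circleMeasure :=
    hTH.memLp_deriv.sub hψ.memLp_deriv
  have hεδ : ε = (4 * Real.pi + 2) * δ := by rw [hδ]; field_simp
  have hsup : ∀ x ∈ Icc 0 (2 * Real.pi), ‖T x - ψ x‖ ≤ ε := by
    intro x hx
    rw [hTH.eq_add_integral hx, hψ.eq_add_integral hx, hT0, add_sub_add_left_eq_sub,
      ← intervalIntegral.integral_sub (intervalIntegrable_of_integrable hTH.integrable_deriv hx)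
        (intervalIntegrable_of_integrable hψ.integrable_deriv hx)]
    refine (intervalIntegral.norm_integral_le_integral_norm hx.1).trans ?_
    have hint : Integrable (fun x => ‖deriv T x - deriv ψ x‖) circleMeasure :=
      (hTH.integrable_deriv.sub hψ.integrable_deriv).norm
    have h1 : ∫ t in (0 : ℝ)..x, ‖deriv T t - deriv ψ t‖ ≤
        ∫ t in (0 : ℝ)..2 * Real.pi, ‖deriv T t - deriv ψ t‖ :=
      intervalIntegral.integral_mono_interval le_rfl hx.1 hx.2
        (ae_of_all _ fun t => norm_nonneg _)
        (intervalIntegrable_of_integrable hint (right_mem_Icc.2 Real.two_pi_pos.le))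
    refine h1.trans ?_
    have h2 := (integral_norm_le_lqNorm hdiff).trans hL2
    rw [integral_circleMeasure, smul_eq_mul, inv_mul_le_iff₀ Real.two_pi_pos] at h2
    refine h2.trans ?_
    rw [hεδ]
    nlinarith
  refine ⟨_, _, fun x => ?_, hL2.trans ?_⟩
  · have hper : Function.Periodic (fun x => T x - ψ x) (2 * Real.pi) := fun x => by
      simp [hTH.periodic x, hψ.periodic x]
    obtain ⟨y, hy, h⟩ := exists_mem_Ioc_eq hper x
    have := hsup y ⟨hy.1.le, hy.2⟩
    rw [← h] at this
    exact this
  · rw [hεδ]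
    nlinarith

lemma MemH1.ofReal {u : ℝ → ℝ} (hu : MemH1 u) : MemH1 (fun x => (u x : ℂ)) ∧
    ∀ᵐ x ∂circleMeasure, deriv (fun x => (u x : ℂ)) x = ((deriv u x : ℝ) : ℂ) := by
  have hae : ∀ᵐ x ∂circleMeasure, deriv (fun x => (u x : ℂ)) x = ((deriv u x : ℝ) : ℂ) := by
    refine ae_circleMeasure_of_ae ?_
    filter_upwards [hu.absolutelyContinuous.ae_differentiableAt] with x hx hx'
    exact (hx hx').hasDerivAt.ofReal_comp.deriv
  refine ⟨⟨fun x => by simp [hu.periodic x], ?_, ?_⟩, hae⟩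
  · have := hu.absolutelyContinuous
    unfold AbsolutelyContinuousOnInterval at this ⊢
    simpa only [Complex.dist_of_im_eq, dist_eq_norm, ← Complex.ofReal_sub, Complex.norm_real] using this
  · have h1 : MemLp (fun x => ((deriv u x : ℝ) : ℂ)) 2 circleMeasure := hu.memLp_deriv.ofReal
    exact (memLp_congr_ae hae).2 h1

/-- Real parts of trigonometric polynomials are dense in the real space `H¹`. -/
lemma MemH1.exists_trigPoly_re {u : ℝ → ℝ} (hu : MemH1 u) {ε : ℝ} (hε : 0 < ε) :
    ∃ (s : Finset ℤ) (c : ℤ → ℂ), (∀ x, |(trigPoly s c x).re - u x| ≤ ε) ∧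
      lqNorm 2 (fun x => deriv (fun x => (trigPoly s c x).re) x - deriv u x) ≤ ε := by
  obtain ⟨hH, hae⟩ := hu.ofReal
  obtain ⟨s, c, h1, h2⟩ := hH.exists_trigPoly hε
  refine ⟨s, c, fun x => ?_, le_trans (lqNorm_mono ?_ ?_) h2⟩
  · refine le_trans ?_ (h1 x)
    have := Complex.abs_re_le_norm (trigPoly s c x - u x)
    simpa using this
  · exact (memH1_of_contDiff (contDiff_trigPoly s c) (periodic_trigPoly s c)).memLp_deriv.sub
      hH.memLp_deriv
  · filter_upwards [hae] with x hx
    rw [hx]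
    have h3 : deriv (fun x => (trigPoly s c x).re) x = (deriv (trigPoly s c) x).re :=
      (Complex.reCLM.hasFDerivAt.comp_hasDerivAt x
        (hasDerivAt_trigPoly s c x).differentiableAt.hasDerivAt).deriv
    rw [h3]
    have := Complex.abs_re_le_norm (deriv (trigPoly s c) x - (deriv u x : ℝ))
    simpa using this

/-! ### From smooth positive functions to `H¹` -/

/-- The regularised modulus `v = √(t² + ε²)` of a trigonometric approximation `t` is smooth and
positive, lies between `|t|` and `|t| + ε`, and satisfies `|v'| = |t t'| / v ≤ |t'|`. A one-sided
bound on the derivative is enough, since `‖v'‖₂` only appears on the larger side of the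
inequalities. -/
lemma MemH1.exists_isSmoothPos {u : ℝ → ℝ} (hu : MemH1 u) {ε : ℝ} (hε : 0 < ε) :
    ∃ v : ℝ → ℝ, IsSmoothPos v ∧ (∀ x, |v x - (|u x|)| ≤ 2 * ε) ∧
      lqNorm 2 (deriv v) ≤ lqNorm 2 (deriv u) + ε := by
  obtain ⟨s, c, h1, h2⟩ := hu.exists_trigPoly_re hε
  set t : ℝ → ℝ := fun x => (trigPoly s c x).re with ht
  have htc : ContDiff ℝ 1 t := Complex.reCLM.contDiff.comp (contDiff_trigPoly s c)
  have htp : Function.Periodic t (2 * Real.pi) := fun x => by simp [ht, periodic_trigPoly s c x]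
  have htH : MemH1 t := memH1_of_contDiff htc htp
  have hpos : ∀ x, 0 < t x ^ 2 + ε ^ 2 := fun x => by positivity
  set v : ℝ → ℝ := fun x => Real.sqrt (t x ^ 2 + ε ^ 2) with hv
  have hvpos : ∀ x, 0 < v x := fun x => Real.sqrt_pos.2 (hpos x)
  have hvsm : IsSmoothPos v :=
    ⟨((htc.pow 2).add contDiff_const).sqrt fun x => (hpos x).ne', fun x => by simp [hv, htp x], hvpos⟩
  have hvt : ∀ x, |t x| ≤ v x := fun x => by
    rw [← Real.sqrt_sq_eq_abs]
    exact Real.sqrt_le_sqrt (by nlinarith)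
  refine ⟨v, hvsm, fun x => ?_, ?_⟩
  · have e1 : v x ≤ |t x| + ε := by
      rw [hv]
      refine Real.sqrt_le_iff.2 ⟨by positivity, ?_⟩
      nlinarith [sq_abs (t x), abs_nonneg (t x)]
    have e2 := hvt x
    have e3 := abs_abs_sub_abs_le_abs_sub (t x) (u x)
    have e4 := h1 x
    rw [abs_le] at e3 ⊢
    constructor <;> linarith
  · have hd : ∀ x, |deriv v x| ≤ |deriv t x| := fun x => by
      have htd := (htc.differentiable (by norm_num) x).hasDerivAt
      have hvd := ((htd.pow 2).add_const (ε ^ 2)).sqrt (hpos x).ne'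
      have : deriv v x = t x * deriv t x / v x := by
        have hvd' : HasDerivAt v _ x := hvd
        rw [hvd'.deriv]
        simp only [hv, Pi.pow_apply]
        have := (hvpos x).ne'
        simp only [hv] at this
        field_simp
        push_cast
        ring
      rw [this, abs_div, abs_mul, abs_of_pos (hvpos x), div_le_iff₀ (hvpos x), mul_comm]
      exact mul_le_mul_of_nonneg_left (hvt x) (abs_nonneg _)
    refine (lqNorm_mono htH.memLp_deriv (ae_of_all _ fun x => by simpa using hd x)).trans ?_
    have := abs_lqNorm_sub_le (q := 2) (by norm_num) htH.memLp_deriv hu.memLp_deriv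
    have := (abs_le.1 this).2
    linarith

/-- The integrand vanishes nowhere because `u θ ^ 2` is finite. This keeps `(∫ u⁻²)⁻¹` away from
`∞`, so that applying `toReal` loses nothing. -/
lemma MemH1.lintegral_inv_sq_ne_zero {u : ℝ → ℝ} (hu : MemH1 u) :
    ∫⁻ θ, (ENNReal.ofReal (u θ ^ 2))⁻¹ ∂circleMeasure ≠ 0 := by
  have hm : AEMeasurable (fun θ => (ENNReal.ofReal (u θ ^ 2))⁻¹) circleMeasure :=
    ((hu.memLp 2).1.aemeasurable.pow_const 2).ennreal_ofReal.inv
  rw [Ne, lintegral_eq_zero_iff' hm]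
  intro h
  have : ∀ᵐ x ∂circleMeasure, False := by
    filter_upwards [h] with x hx
    simp at hx
  simp only [eventually_false_iff_eq_bot, ae_eq_bot] at this
  exact IsProbabilityMeasure.ne_zero circleMeasure this

/-- Upper semicontinuity of `u ↦ ‖u⁻¹‖₂⁻²` under pointwise convergence of the moduli. -/
lemma eventually_invNormInvSq_le {u : ℝ → ℝ} (hu : MemH1 u) {v : ℕ → ℝ → ℝ}
    (hv : ∀ n, Continuous (v n)) (hlim : ∀ x, Tendsto (fun n => v n x) atTop (𝓝 |u x|)) {η : ℝ}
    (hη : 0 < η) : ∀ᶠ n in atTop, invNormInvSq (v n) ≤ invNormInvSq u + η := by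
  set I : (ℝ → ℝ) → ℝ≥0∞ := fun w => ∫⁻ θ, (ENNReal.ofReal (w θ ^ 2))⁻¹ ∂circleMeasure with hI
  -- Fatou's lemma in `[0, ∞]`: the zeros of `u` need no separate treatment, and inversion turns
  -- lower into upper semicontinuity.
  have hfatou : I u ≤ liminf (fun n => I (v n)) atTop := by
    refine le_trans (le_of_eq ?_) (lintegral_liminf_le fun n => ?_)
    · refine lintegral_congr fun x => ?_
      have h1 : Tendsto (fun n => (ENNReal.ofReal (v n x ^ 2))⁻¹) atTop
          (𝓝 (ENNReal.ofReal (u x ^ 2))⁻¹) := by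
        have := (hlim x).pow 2
        rw [sq_abs] at this
        exact (ENNReal.tendsto_ofReal this).inv
      exact h1.liminf_eq.symm
    · exact (((hv n).pow 2).measurable.ennreal_ofReal).inv
  have hfin : (I u)⁻¹ ≠ ∞ := ENNReal.inv_ne_top.2 hu.lintegral_inv_sq_ne_zero
  have hlt : limsup (fun n => (I (v n))⁻¹) atTop < (I u)⁻¹ + ENNReal.ofReal η := by
    have h1 : limsup (fun n => (I (v n))⁻¹) atTop ≤ (I u)⁻¹ := by
      have := ENNReal.inv_liminf (x := fun n => I (v n)) (l := atTop)
      rw [← this]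
      exact ENNReal.inv_le_inv.2 hfatou
    exact h1.trans_lt (ENNReal.lt_add_right hfin (by simpa using hη))
  filter_upwards [eventually_lt_of_limsup_lt hlt] with n hn
  have h2 := ENNReal.toReal_mono (ENNReal.add_ne_top.2 ⟨hfin, ENNReal.ofReal_ne_top⟩) hn.le
  rwa [ENNReal.toReal_add hfin ENNReal.ofReal_ne_top, ENNReal.toReal_ofReal hη.le] at h2

/-- Inequalities between the four quadratic quantities extend from smooth positive functions to
`H¹`. -/
lemma MemH1.inequality_of_isSmoothPos {p α β γ δ : ℝ} (hp : 1 ≤ p) (hβ : 0 ≤ β) (hγ : 0 ≤ γ)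
    (h : ∀ v : ℝ → ℝ, IsSmoothPos v → α * lqNorm 2 v ^ 2 ≤ β * lqNorm 2 (deriv v) ^ 2
      + γ * invNormInvSq v + δ * lqNorm (ENNReal.ofReal p) v ^ 2)
    {u : ℝ → ℝ} (hu : MemH1 u) :
    α * lqNorm 2 u ^ 2 ≤ β * lqNorm 2 (deriv u) ^ 2 + γ * invNormInvSq u
      + δ * lqNorm (ENNReal.ofReal p) u ^ 2 := by
  have hε : ∀ n : ℕ, (0 : ℝ) < 1 / ((n : ℝ) + 1) := fun n => by positivity
  choose v hv h1 h2 using fun n => hu.exists_isSmoothPos (hε n)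
  have hε0 : Tendsto (fun n : ℕ => 1 / ((n : ℝ) + 1)) atTop (𝓝 0) :=
    tendsto_one_div_add_atTop_nhds_zero_nat
  have h2ε0 : Tendsto (fun n : ℕ => 2 * (1 / ((n : ℝ) + 1))) atTop (𝓝 0) := by
    simpa using hε0.const_mul 2
  have hlq : ∀ q : ℝ≥0∞, 1 ≤ q → Tendsto (fun n => lqNorm q (v n)) atTop (𝓝 (lqNorm q u)) := by
    intro q hq
    have e : lqNorm q u = lqNorm q (fun x => |u x|) :=
      lqNorm_congr_norm q (ae_of_all _ fun x => by simp)
    rw [e]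
    refine tendsto_lqNorm_of_uniform hq (fun n => (hv n).memH1.memLp q) ?_ h2ε0
      fun n x _ => h1 n x
    exact (hu.memLp q).norm
  have hlim : ∀ x, Tendsto (fun n => v n x) atTop (𝓝 |u x|) := fun x => by
    rw [tendsto_iff_dist_tendsto_zero]
    exact squeeze_zero (fun _ => dist_nonneg) (fun n => h1 n x) h2ε0
  have hpq : (1 : ℝ≥0∞) ≤ ENNReal.ofReal p := by simpa using hp
  refine le_of_forall_pos_le_add fun η hη => ?_
  -- Dividing by `γ + 1` rather than `γ` covers `γ = 0`.
  have hη' : 0 < η / (γ + 1) := by positivity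
  have hev := eventually_invNormInvSq_le hu (fun n => (hv n).continuous) hlim hη'
  have T1 := ((hlq 2 (by norm_num)).pow 2).const_mul α
  have T2 := ((((tendsto_const_nhds (x := lqNorm 2 (deriv u))).add hε0).pow 2).const_mul β).add
    ((tendsto_const_nhds (x := γ * (invNormInvSq u + η / (γ + 1)))).add
      (((hlq _ hpq).pow 2).const_mul δ))
  have := le_of_tendsto_of_tendsto T1 T2 (by
    filter_upwards [hev] with n hn
    refine (h (v n) (hv n)).trans ?_
    have e1 := mul_le_mul_of_nonneg_left
      (pow_le_pow_left₀ (lqNorm_nonneg _ _) (h2 n) 2) hβ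
    have e2 := mul_le_mul_of_nonneg_left hn hγ
    linarith)
  rw [add_zero] at this
  have e3 : γ * (η / (γ + 1)) ≤ η := by
    rw [mul_div_assoc', div_le_iff₀ (by positivity)]
    nlinarith
  linarith

/-- A lower bound for the scalar energy of smooth positive functions is a lower bound for the
magnetic energy. -/
lemma MemH1.le_magneticEnergy {a p μ Λ : ℝ} (ha₀ : 0 < a) (ha₁ : a < 1 / 2) (hp : 1 ≤ p)
    (h : ∀ u : ℝ → ℝ, IsSmoothPos u → Λ * lqNorm 2 u ^ 2 ≤ scalarEnergy a p μ u)
    {ψ : ℝ → ℂ} (hψ : MemH1 ψ) : Λ * lqNorm 2 ψ ^ 2 ≤ magneticEnergy a p μ ψ := by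
  have hpq : (1 : ℝ≥0∞) ≤ ENNReal.ofReal p := by simpa using hp
  have step : ∀ ε : ℝ, 0 < ε → ∃ φ : ℝ → ℂ, MemH1 φ ∧
      Λ * lqNorm 2 φ ^ 2 ≤ magneticEnergy a p μ φ ∧ (∀ x, ‖φ x - ψ x‖ ≤ 2 * ε) ∧
      lqNorm 2 (fun x => deriv φ x - deriv ψ x) ≤ ε := by
    intro ε hε
    obtain ⟨s, c, h1, h2⟩ := hψ.exists_trigPoly hε
    -- A smooth curve in the plane has dense complement. Subtracting a small value it omits makes
    -- the function non-vanishing without changing its derivative.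
    have hdense : Dense (range (trigPoly s c))ᶜ :=
      (contDiff_trigPoly s c).dense_compl_range_of_finrank_lt_finrank (by simp)
    obtain ⟨y, hy, hyε⟩ := hdense.exists_dist_lt 0 hε
    rw [dist_zero_left] at hyε
    have hφc : ContDiff ℝ 1 fun x => trigPoly s c x - y := (contDiff_trigPoly s c).sub contDiff_const
    have hφp : Function.Periodic (fun x => trigPoly s c x - y) (2 * Real.pi) := fun x => by
      simp [periodic_trigPoly s c x]
    have hφ0 : ∀ x, trigPoly s c x - y ≠ 0 := fun x hx => hy ⟨x, sub_eq_zero.1 hx⟩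
    obtain ⟨h3, h4⟩ := scalarEnergy_norm_le hφc hφp hφ0 ha₀ ha₁ p μ
    refine ⟨_, memH1_of_contDiff hφc hφp, ?_, fun x => ?_, ?_⟩
    · refine le_trans (le_of_eq ?_) ((h _ h3).trans h4)
      congr 2
      exact lqNorm_congr_norm 2 (ae_of_all _ fun x => by simp)
    · have := norm_sub_le (trigPoly s c x - ψ x) y
      rw [show trigPoly s c x - y - ψ x = trigPoly s c x - ψ x - y by ring]
      linarith [h1 x]
    · simpa only [deriv_sub_const] using h2
  have hε : ∀ n : ℕ, (0 : ℝ) < 1 / ((n : ℝ) + 1) := fun n => by positivity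
  choose φ hφ h1 h2 h3 using fun n => step _ (hε n)
  have hε0 : Tendsto (fun n : ℕ => 1 / ((n : ℝ) + 1)) atTop (𝓝 0) :=
    tendsto_one_div_add_atTop_nhds_zero_nat
  have h2ε0 : Tendsto (fun n : ℕ => 2 * (1 / ((n : ℝ) + 1))) atTop (𝓝 0) := by
    simpa using hε0.const_mul 2
  have hlq : ∀ q : ℝ≥0∞, 1 ≤ q → Tendsto (fun n => lqNorm q (φ n)) atTop (𝓝 (lqNorm q ψ)) :=
    fun q hq => tendsto_lqNorm_of_uniform hq (fun n => (hφ n).memLp q) (hψ.memLp q) h2ε0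
      fun n x _ => h2 n x
  have hmem : ∀ {χ : ℝ → ℂ}, MemH1 χ →
      MemLp (fun x => deriv χ x - Complex.I * (a : ℂ) * χ x) 2 circleMeasure := fun hχ =>
    hχ.memLp_deriv.sub ((hχ.memLp 2).const_mul _)
  have hkin : Tendsto (fun n => lqNorm 2 (fun x => deriv (φ n) x - Complex.I * (a : ℂ) * φ n x)) atTop
      (𝓝 (lqNorm 2 (fun x => deriv ψ x - Complex.I * (a : ℂ) * ψ x))) := by
    refine tendsto_lqNorm (by norm_num) (fun n => hmem (hφ n)) (hmem hψ) ?_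
    have hz := hε0.add (h2ε0.const_mul a)
    rw [mul_zero, add_zero] at hz
    refine squeeze_zero (fun _ => lqNorm_nonneg _ _) (fun n => ?_) hz
    have e : (fun x => (deriv (φ n) x - Complex.I * (a : ℂ) * φ n x) -
        (deriv ψ x - Complex.I * (a : ℂ) * ψ x)) = fun x => (deriv (φ n) x - deriv ψ x) +
          (-(Complex.I * (a : ℂ))) * (φ n x - ψ x) := by
      funext x; ring
    have hm1 : MemLp (fun x => φ n x - ψ x) 2 circleMeasure := ((hφ n).memLp 2).sub (hψ.memLp 2)
    rw [e]
    refine (lqNorm_add_le (by norm_num) ((hφ n).memLp_deriv.sub hψ.memLp_deriv)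
      (hm1.const_mul _)).trans ?_
    rw [lqNorm_const_mul]
    have e1 : ‖-(Complex.I * (a : ℂ))‖ = a := by simp [abs_of_pos ha₀]
    rw [e1]
    refine add_le_add (h3 n) (mul_le_mul_of_nonneg_left ?_ ha₀.le)
    exact lqNorm_le_of_bound (by have := hε n; positivity) 2 (ae_of_all _ (h2 n))
  exact le_of_tendsto_of_tendsto' (((hlq 2 (by norm_num)).pow 2).const_mul Λ)
    ((hkin.pow 2).add (((hlq _ hpq).pow 2).const_mul μ)) h1

/-! ### Interpolation inequalities by the heat flow -/

/-- Differentiation under the integral sign over the circle. -/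
lemma hasDerivAt_integral_circle {F F' : ℝ → ℝ → ℝ} {U : Set ℝ} {t₀ : ℝ} (hU : U ∈ 𝓝 t₀)
    (hF : ∀ t ∈ U, Continuous (F t))
    (hF' : ContinuousOn (fun z : ℝ × ℝ => F' z.1 z.2) (U ×ˢ Icc 0 (2 * Real.pi)))
    (hd : ∀ t ∈ U, ∀ x, HasDerivAt (fun t => F t x) (F' t x) t) :
    HasDerivAt (fun t => ∫ x, F t x ∂circleMeasure) (∫ x, F' t₀ x ∂circleMeasure) t₀ := by
  obtain ⟨r, hr, hrU⟩ := Metric.nhds_basis_closedBall.mem_iff.1 hU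
  have hK : IsCompact (Metric.closedBall t₀ r ×ˢ Icc (0 : ℝ) (2 * Real.pi)) :=
    (isCompact_closedBall t₀ r).prod isCompact_Icc
  -- Compactness of a closed time interval times one period makes a constant an admissible
  -- dominating function.
  obtain ⟨C, hC⟩ := hK.exists_bound_of_continuousOn (hF'.mono (prod_mono_left hrU))
  have ht₀ : t₀ ∈ U := mem_of_mem_nhds hU
  refine (hasDerivAt_integral_of_dominated_loc_of_deriv_le (bound := fun _ => C)
    (Metric.closedBall_mem_nhds t₀ hr) ?_ (integrable_of_continuous (hF t₀ ht₀)) ?_ ?_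
    (integrable_const _) ?_).2
  · filter_upwards [hU] with t ht
    exact (hF t ht).aestronglyMeasurable
  · refine (memLp_of_continuousOn (f := F' t₀) ?_ 2).1
    exact hF'.comp (f := fun x : ℝ => (t₀, x)) (by fun_prop) fun x hx => ⟨ht₀, hx⟩
  · exact ae_circleMeasure_of_forall_Ioc fun x hx t ht => hC (t, x) ⟨ht, hx.1.le, hx.2⟩
  · exact ae_of_all _ fun x t ht => hd t (hrU ht) x

lemma hasDerivAt_rpow {f f' : ℝ → ℝ} (hf : ∀ x, HasDerivAt f (f' x) x) (h0 : ∀ x, 0 < f x)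
    (r x : ℝ) : HasDerivAt (fun x => f x ^ r) (r * f x ^ (r - 1) * f' x) x := by
  refine ((hf x).rpow_const (p := r) (Or.inl (h0 x).ne')).congr_deriv ?_
  ring

lemma integral_lin_comb {f g h : ℝ → ℝ} (hf : Integrable f circleMeasure)
    (hg : Integrable g circleMeasure) (hh : Integrable h circleMeasure) (α β γ : ℝ) :
    ∫ x, (α * f x + β * g x + γ * h x) ∂circleMeasure = α * (∫ x, f x ∂circleMeasure)
      + β * (∫ x, g x ∂circleMeasure) + γ * ∫ x, h x ∂circleMeasure := by
  have h12 : Integrable (fun x => α * f x + β * g x) circleMeasure :=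
    (hf.const_mul α).add (hg.const_mul β)
  rw [integral_add h12 (hh.const_mul γ), integral_add (hf.const_mul α) (hg.const_mul β),
    integral_const_mul, integral_const_mul, integral_const_mul]

/-- The entropy production along the heat flow is dissipated at least exponentially. -/
lemma fisher_dissipation {f A B C : ℝ → ℝ} (hf : ∀ x, HasDerivAt f (A x) x)
    (hA : ∀ x, HasDerivAt A (B x) x) (hB : ∀ x, HasDerivAt B (C x) x) (hC : Continuous C)
    (hp : Function.Periodic f (2 * Real.pi)) (hpA : Function.Periodic A (2 * Real.pi))
    (hpB : Function.Periodic B (2 * Real.pi))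
    (h0 : ∀ x, 0 < f x) {q : ℝ} (hq₀ : 0 < q) (hq₂ : q < 2) :
    ∫ x, ((q - 2) * f x ^ (q - 3) * B x * A x ^ 2 + f x ^ (q - 2) * (2 * A x * C x)) ∂circleMeasure
      ≤ -2 * (∫ x, f x ^ (q - 2) * A x ^ 2 ∂circleMeasure)
        - q * (2 - q) / 6 * (∫ x, f x ^ (q - 2) * A x ^ 2 ∂circleMeasure) ^ 2
          / ∫ x, f x ^ q ∂circleMeasure := by
  have cf : Continuous f := continuous_iff_continuousAt.2 fun x => (hf x).continuousAt
  have cA : Continuous A := continuous_iff_continuousAt.2 fun x => (hA x).continuousAt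
  have cB : Continuous B := continuous_iff_continuousAt.2 fun x => (hB x).continuousAt
  have cr : ∀ r : ℝ, Continuous fun x => f x ^ r := fun r =>
    cf.rpow_const fun x => Or.inl (h0 x).ne'
  have cP := cr (q - 4)
  have cR := cr (q / 2 - 2)
  -- All powers of `f` are expressed through `f ^ (q - 4)`, the square of `f ^ (q / 2 - 2)`, so that
  -- the remaining identities are polynomial.
  have e3 : ∀ x, f x ^ (q - 3) = f x ^ (q - 4) * f x := fun x => by
    rw [← Real.rpow_add_one (h0 x).ne']; congr 1; ring
  have e2 : ∀ x, f x ^ (q - 2) = f x ^ (q - 4) * f x ^ 2 := fun x => by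
    rw [← Real.rpow_add_natCast (h0 x).ne']; congr 1; push_cast; ring
  have e0 : ∀ x, f x ^ q = f x ^ (q - 4) * f x ^ 4 := fun x => by
    rw [← Real.rpow_add_natCast (h0 x).ne']; congr 1; push_cast; ring
  have eR1 : ∀ x, f x ^ (q / 2 - 1) = f x ^ (q / 2 - 2) * f x := fun x => by
    rw [← Real.rpow_add_one (h0 x).ne']; congr 1; ring
  have eR : ∀ x, f x ^ (q - 4) = (f x ^ (q / 2 - 2)) ^ 2 := fun x => by
    rw [← Real.rpow_mul_natCast (h0 x).le]; congr 1; push_cast; ring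
  set a1 := ∫ x, f x ^ (q - 4) * f x * A x ^ 2 * B x ∂circleMeasure with ha1
  set a2 := ∫ x, f x ^ (q - 4) * f x ^ 2 * B x ^ 2 ∂circleMeasure with ha2
  set a3 := ∫ x, f x ^ (q - 4) * f x ^ 2 * (A x * C x) ∂circleMeasure with ha3
  set X := ∫ x, f x ^ (q - 4) * A x ^ 4 ∂circleMeasure with hX
  set D := ∫ x, f x ^ (q - 2) * A x ^ 2 ∂circleMeasure with hD
  set E := ∫ x, f x ^ q ∂circleMeasure with hE
  have i1 : Integrable (fun x => f x ^ (q - 4) * f x * A x ^ 2 * B x) circleMeasure :=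
    integrable_of_continuous (by fun_prop)
  have i2 : Integrable (fun x => f x ^ (q - 4) * f x ^ 2 * B x ^ 2) circleMeasure :=
    integrable_of_continuous (by fun_prop)
  have i3 : Integrable (fun x => f x ^ (q - 4) * f x ^ 2 * (A x * C x)) circleMeasure :=
    integrable_of_continuous (by fun_prop)
  have iX : Integrable (fun x => f x ^ (q - 4) * A x ^ 4) circleMeasure :=
    integrable_of_continuous (by fun_prop)
  have iD : Integrable (fun x => f x ^ (q - 2) * A x ^ 2) circleMeasure :=
    integrable_of_continuous ((cr _).mul (cA.pow 2))
  have iE : Integrable (fun x => f x ^ q) circleMeasure := integrable_of_continuous (cr q)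
  have hEpos : 0 < E := by
    rw [hE, integral_pos_iff_support_of_nonneg (fun x => (Real.rpow_pos_of_pos (h0 x) q).le) iE]
    have : Function.support (fun x => f x ^ q) = univ :=
      Set.eq_univ_of_forall fun x => (Real.rpow_pos_of_pos (h0 x) q).ne'
    rw [this, measure_univ]
    exact one_pos
  have hlhs : ∫ x, ((q - 2) * f x ^ (q - 3) * B x * A x ^ 2
      + f x ^ (q - 2) * (2 * A x * C x)) ∂circleMeasure = (q - 2) * a1 + 2 * a3 := by
    rw [ha1, ha3, ← integral_const_mul, ← integral_const_mul,
      ← integral_add (i1.const_mul _) (i3.const_mul _)]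
    refine integral_congr_ae (ae_of_all _ fun x => ?_)
    simp only
    rw [e3, e2]
    ring
  -- Integration by parts, from the exact derivative of `f^(q-2) f' f''`, eliminates the third
  -- derivative. The next identity, from `f^(q-3) f'^3`, expresses `a1` through `X`.
  have ibp1 : (q - 2) * a1 + a2 + a3 = 0 := by
    have h := integral_deriv_eq_zero_of_periodic
      (F := fun x => f x ^ (q - 2) * (A x * B x))
      (f := fun x => (q - 2) * (f x ^ (q - 4) * f x * A x ^ 2 * B x)
        + 1 * (f x ^ (q - 4) * f x ^ 2 * B x ^ 2)
        + 1 * (f x ^ (q - 4) * f x ^ 2 * (A x * C x))) ?_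
      (by fun_prop) (fun x => by simp [hp x, hpA x, hpB x])
    · rw [integral_lin_comb i1 i2 i3, one_mul, one_mul] at h
      exact h
    · intro x
      refine ((hasDerivAt_rpow hf h0 (q - 2) x).mul ((hA x).mul (hB x))).congr_deriv ?_
      rw [show q - 2 - 1 = q - 3 by ring, e3, e2]
      simp only [Pi.mul_apply]
      ring
  have ibp2 : (q - 3) * X + 3 * a1 = 0 := by
    have h := integral_deriv_eq_zero_of_periodic
      (F := fun x => f x ^ (q - 3) * A x ^ 3)
      (f := fun x => (q - 3) * (f x ^ (q - 4) * A x ^ 4)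
        + 3 * (f x ^ (q - 4) * f x * A x ^ 2 * B x)) ?_
      (by fun_prop) (fun x => by simp [hp x, hpA x])
    · rw [integral_add (iX.const_mul _) (i1.const_mul _), integral_const_mul,
        integral_const_mul] at h
      exact h
    · intro x
      refine ((hasDerivAt_rpow hf h0 (q - 3) x).mul ((hA x).pow 3)).congr_deriv ?_
      rw [show q - 3 - 1 = q - 4 by ring, e3]
      simp only [Pi.pow_apply]
      push_cast
      ring
  -- Wirtinger's inequality for the derivative of `f^(q/2)`, which has zero mean.
  have hW : D ≤ a2 + (q - 2) * a1 + (q - 2) ^ 2 / 4 * X := by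
    have cR1 := cr (q / 2 - 1)
    have hux : ∀ x, HasDerivAt (fun x => f x ^ (q / 2)) (q / 2 * f x ^ (q / 2 - 1) * A x) x :=
      hasDerivAt_rpow hf h0 (q / 2)
    have huxx : ∀ x, HasDerivAt (fun x => q / 2 * f x ^ (q / 2 - 1) * A x)
        (q / 2 * ((q / 2 - 1) * f x ^ (q / 2 - 2) * A x ^ 2
          + f x ^ (q / 2 - 2) * f x * B x)) x := fun x => by
      refine (((hasDerivAt_rpow hf h0 (q / 2 - 1) x).const_mul (q / 2)).mul (hA x)).congr_deriv ?_
      rw [show q / 2 - 1 - 1 = q / 2 - 2 by ring, eR1]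
      ring
    have h := integral_sq_le_of_periodic huxx (by fun_prop) (fun x => by simp [hp x, hpA x])
      (integral_deriv_eq_zero_of_periodic hux (by fun_prop) (fun x => by simp [hp x]))
    have l : ∫ x, (q / 2 * f x ^ (q / 2 - 1) * A x) ^ 2 ∂circleMeasure = q ^ 2 / 4 * D := by
      rw [hD, ← integral_const_mul]
      refine integral_congr_ae (ae_of_all _ fun x => ?_)
      simp only
      rw [eR1, e2, eR]
      ring
    have r : ∫ x, (q / 2 * ((q / 2 - 1) * f x ^ (q / 2 - 2) * A x ^ 2
          + f x ^ (q / 2 - 2) * f x * B x)) ^ 2 ∂circleMeasure =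
        q ^ 2 / 4 * (a2 + (q - 2) * a1 + (q - 2) ^ 2 / 4 * X) := by
      rw [← one_mul a2, ha1, ha2, hX, ← integral_lin_comb i2 i1 iX, ← integral_const_mul]
      refine integral_congr_ae (ae_of_all _ fun x => ?_)
      simp only
      rw [eR]
      ring
    rw [l, r] at h
    exact le_of_mul_le_mul_left h (by positivity)
  -- Cauchy–Schwarz applied to `D = ∫ (f^(q/2-2) f'²) f^(q/2)`.
  have hCS : D ^ 2 / E ≤ X := by
    have h1 : 0 ≤ ∫ x, (f x ^ (q / 2 - 2) * A x ^ 2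
        - D / E * (f x ^ (q / 2 - 2) * f x ^ 2)) ^ 2 ∂circleMeasure :=
      integral_nonneg fun x => sq_nonneg _
    have h2 : ∫ x, (f x ^ (q / 2 - 2) * A x ^ 2
        - D / E * (f x ^ (q / 2 - 2) * f x ^ 2)) ^ 2 ∂circleMeasure
        = X - 2 * (D / E) * D + (D / E) ^ 2 * E := by
      have h := integral_lin_comb iX iD iE 1 (-(2 * (D / E))) ((D / E) ^ 2)
      rw [← hX, ← hD, ← hE] at h
      rw [show X - 2 * (D / E) * D + (D / E) ^ 2 * E =
        1 * X + -(2 * (D / E)) * D + (D / E) ^ 2 * E by ring, ← h]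
      refine integral_congr_ae (ae_of_all _ fun x => ?_)
      simp only
      rw [e2, e0, eR]
      ring
    rw [h2] at h1
    have h3 : X - 2 * (D / E) * D + (D / E) ^ 2 * E = X - D ^ 2 / E := by field_simp; ring
    linarith
  rw [hlhs]
  have hfin : q * (2 - q) / 6 * D ^ 2 / E ≤ q * (2 - q) / 6 * X := by
    rw [mul_div_assoc]
    exact mul_le_mul_of_nonneg_left hCS (by nlinarith)
  have ha1X : a1 = (3 - q) / 3 * X := by linarith
  have ha3' : a3 = -a2 - (q - 2) * a1 := by linarith
  -- After the Wirtinger combination is split off, a multiple of `X` remains with a favourable sign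
  -- because `0 < q < 2`. It is the source of the improved inequality.
  have key : (q - 2) * a1 + 2 * a3 = -2 * (a2 + (q - 2) * a1 + (q - 2) ^ 2 / 4 * X)
      - q * (2 - q) / 6 * X := by
    rw [ha3', ha1X]
    ring
  rw [key]
  linarith

/-! ### Entropy and entropy production along the heat flow. -/

/-- A classical positive periodic solution of the heat equation on `[0, ∞)` (extended to negative
times as a possibly non-positive solution), with its first three space derivatives, that converges
uniformly to a constant. -/
structure HeatFlow (f A B C : ℝ → ℝ → ℝ) (m : ℝ) : Prop where
  deriv_f : ∀ t x, HasDerivAt (f t) (A t x) x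
  deriv_A : ∀ t x, HasDerivAt (A t) (B t x) x
  deriv_B : ∀ t x, HasDerivAt (B t) (C t x) x
  deriv_time : ∀ t x, HasDerivAt (fun t => f t x) (B t x) t
  deriv_time_A : ∀ t x, HasDerivAt (fun t => A t x) (C t x) t
  continuous_f : Continuous fun z : ℝ × ℝ => f z.1 z.2
  continuous_A : Continuous fun z : ℝ × ℝ => A z.1 z.2
  continuous_B : Continuous fun z : ℝ × ℝ => B z.1 z.2
  continuous_C : Continuous fun z : ℝ × ℝ => C z.1 z.2
  periodic_f : ∀ t, Function.Periodic (f t) (2 * Real.pi)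
  periodic_A : ∀ t, Function.Periodic (A t) (2 * Real.pi)
  periodic_B : ∀ t, Function.Periodic (B t) (2 * Real.pi)
  pos : ∀ t, 0 ≤ t → ∀ x, 0 < f t x
  lim : ∃ δ : ℝ → ℝ, Tendsto δ atTop (𝓝 0) ∧ ∀ t x, |f t x - m| ≤ δ t

namespace HeatFlow

variable {f A B C : ℝ → ℝ → ℝ} {m : ℝ} (h : HeatFlow f A B C m)
include h

lemma continuous_slice (t : ℝ) : Continuous (f t) :=
  h.continuous_f.comp (by fun_prop : Continuous fun x : ℝ => (t, x))

lemma continuous_slice_A (t : ℝ) : Continuous (A t) :=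
  h.continuous_A.comp (by fun_prop : Continuous fun x : ℝ => (t, x))

lemma continuous_slice_B (t : ℝ) : Continuous (B t) :=
  h.continuous_B.comp (by fun_prop : Continuous fun x : ℝ => (t, x))

lemma continuous_slice_C (t : ℝ) : Continuous (C t) :=
  h.continuous_C.comp (by fun_prop : Continuous fun x : ℝ => (t, x))

/-- By compactness of a period, positivity persists for nearby times, including slightly negative
ones. This allows two-sided time derivatives at `t = 0`. -/
lemma pos_mem_nhds {t : ℝ} (ht : 0 ≤ t) : {s | ∀ x, 0 < f s x} ∈ 𝓝 t := by
  have h1 : ∀ᶠ s in 𝓝 t, ∀ x ∈ Icc (0 : ℝ) (2 * Real.pi), 0 < f s x :=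
    isCompact_Icc.eventually_forall_of_forall_eventually fun x _ =>
      h.continuous_f.continuousAt.eventually (lt_mem_nhds (h.pos t ht x))
  filter_upwards [h1] with s hs x
  obtain ⟨y, hy, e⟩ := exists_mem_Ioc_eq (h.periodic_f s) x
  rw [e]
  exact hs y ⟨hy.1.le, hy.2⟩

lemma continuousOn_rpow (r : ℝ) :
    ContinuousOn (fun z : ℝ × ℝ => f z.1 z.2 ^ r)
      ({s | ∀ x, 0 < f s x} ×ˢ Icc 0 (2 * Real.pi)) :=
  h.continuous_f.continuousOn.rpow_const fun z hz => Or.inl (hz.1 z.2).ne'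

lemma continuous_slice_rpow {t : ℝ} (ht : ∀ x, 0 < f t x) (r : ℝ) :
    Continuous fun x => f t x ^ r :=
  (h.continuous_slice t).rpow_const fun x => Or.inl (ht x).ne'

/-- The mass is conserved, since the second space derivative has zero mean, and uniform convergence
identifies it with `m`. -/
lemma integral_eq_const : ∫ x, f 0 x ∂circleMeasure = m := by
  have hd : ∀ t, HasDerivAt (fun t => ∫ x, f t x ∂circleMeasure) 0 t := fun t => by
    have h1 := hasDerivAt_integral_circle (F := f) (F' := B) (t₀ := t) univ_mem
      (fun t _ => h.continuous_slice t) h.continuous_B.continuousOn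
      (fun t _ x => h.deriv_time t x)
    rwa [integral_deriv_eq_zero_of_periodic (h.deriv_A t) (h.continuous_slice_B t)
      (h.periodic_A t)] at h1
  have hc : ∀ t, ∫ x, f t x ∂circleMeasure = ∫ x, f 0 x ∂circleMeasure := fun t =>
    is_const_of_deriv_eq_zero (fun x => (hd x).differentiableAt) (fun x => (hd x).deriv) t 0
  obtain ⟨δ, hδ, hb⟩ := h.lim
  have hle : ∀ t, |(∫ x, f 0 x ∂circleMeasure) - m| ≤ δ t := fun t => by
    rw [← hc t]
    have e : (∫ x, f t x ∂circleMeasure) - m = ∫ x, (f t x - m) ∂circleMeasure := by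
      rw [integral_sub (integrable_of_continuous (h.continuous_slice t)) (integrable_const _)]
      simp
    rw [e, ← Real.norm_eq_abs]
    refine (norm_integral_le_integral_norm _).trans ?_
    refine (integral_mono (g := fun _ => δ t) ?_ (integrable_const _) (fun x => hb t x)).trans ?_
    · exact ((integrable_of_continuous (h.continuous_slice t)).sub (integrable_const _)).norm
    · simp
  have h0 : |(∫ x, f 0 x ∂circleMeasure) - m| ≤ 0 := ge_of_tendsto' hδ hle
  exact sub_eq_zero.1 (abs_nonpos_iff.1 h0)

lemma hasDerivAt_entropy {q : ℝ} {t : ℝ} (ht : 0 ≤ t) :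
    HasDerivAt (fun t => ∫ x, f t x ^ q ∂circleMeasure)
      (-(q * (q - 1) * ∫ x, f t x ^ (q - 2) * A t x ^ 2 ∂circleMeasure)) t := by
  have hpos := h.pos t ht
  have h1 := hasDerivAt_integral_circle (F := fun t x => f t x ^ q)
    (F' := fun t x => q * f t x ^ (q - 1) * B t x) (h.pos_mem_nhds ht)
    (fun s hs => h.continuous_slice_rpow hs q)
    (((h.continuousOn_rpow (q - 1)).const_mul q).mul h.continuous_B.continuousOn)
    (fun s hs x => by
      refine ((h.deriv_time s x).rpow_const (p := q) (Or.inl (hs x).ne')).congr_deriv ?_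
      ring)
  convert! h1 using 1
  have c1 := h.continuous_slice_rpow hpos (q - 1)
  have c2 := h.continuous_slice_rpow hpos (q - 2)
  have cA := h.continuous_slice_A t
  have cB := h.continuous_slice_B t
  have ibp := integral_deriv_eq_zero_of_periodic (F := fun x => q * (f t x ^ (q - 1) * A t x))
    (f := fun x => q * (q - 1) * (f t x ^ (q - 2) * A t x ^ 2) + q * f t x ^ (q - 1) * B t x)
    (fun x => by
      refine (((hasDerivAt_rpow (h.deriv_f t) hpos (q - 1) x).mul
        (h.deriv_A t x)).const_mul q).congr_deriv ?_
      rw [show q - 1 - 1 = q - 2 by ring]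
      ring) (by fun_prop) (fun x => by simp [h.periodic_f t x, h.periodic_A t x])
  rw [integral_add (integrable_of_continuous (by fun_prop))
    (integrable_of_continuous (by fun_prop)), integral_const_mul] at ibp
  linarith

lemma hasDerivAt_fisher {q : ℝ} {t : ℝ} (ht : 0 ≤ t) :
    HasDerivAt (fun t => ∫ x, f t x ^ (q - 2) * A t x ^ 2 ∂circleMeasure)
      (∫ x, ((q - 2) * f t x ^ (q - 3) * B t x * A t x ^ 2
        + f t x ^ (q - 2) * (2 * A t x * C t x)) ∂circleMeasure) t := by
  refine hasDerivAt_integral_circle (F := fun t x => f t x ^ (q - 2) * A t x ^ 2)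
    (F' := fun t x => (q - 2) * f t x ^ (q - 3) * B t x * A t x ^ 2
      + f t x ^ (q - 2) * (2 * A t x * C t x)) (h.pos_mem_nhds ht)
    (fun s hs => (h.continuous_slice_rpow hs _).mul ((h.continuous_slice_A s).pow 2)) ?_ ?_
  · have c1 := h.continuousOn_rpow (q - 3)
    have c2 := h.continuousOn_rpow (q - 2)
    have cA := h.continuous_A.continuousOn (s := {s | ∀ x, 0 < f s x} ×ˢ Icc 0 (2 * Real.pi))
    have cB := h.continuous_B.continuousOn (s := {s | ∀ x, 0 < f s x} ×ˢ Icc 0 (2 * Real.pi))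
    have cC := h.continuous_C.continuousOn (s := {s | ∀ x, 0 < f s x} ×ˢ Icc 0 (2 * Real.pi))
    fun_prop
  · intro s hs x
    refine (((h.deriv_time s x).rpow_const (p := q - 2) (Or.inl (hs x).ne')).mul
      ((h.deriv_time_A s x).pow 2)).congr_deriv ?_
    rw [show q - 2 - 1 = q - 3 by ring]
    simp only [Pi.pow_apply]
    push_cast
    ring

/-- Improved entropy - entropy production inequality for the initial datum of the heat flow. -/
lemma entropy_le {q : ℝ} (hq₁ : 1 < q) (hq₂ : q < 2) :
    (∫ x, f 0 x ^ q ∂circleMeasure)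
      - 6 * (q - 1) / (2 - q) * (∫ x, f 0 x ^ q ∂circleMeasure) *
        Real.log (1 + q * (2 - q) / 12 * (∫ x, f 0 x ^ (q - 2) * A 0 x ^ 2 ∂circleMeasure)
          / ∫ x, f 0 x ^ q ∂circleMeasure)
      ≤ (∫ x, f 0 x ∂circleMeasure) ^ q := by
  have hq0 : 0 < q := by linarith
  have h2q : 0 < 2 - q := by linarith
  set e : ℝ → ℝ := fun t => ∫ x, f t x ^ q ∂circleMeasure with he
  set D : ℝ → ℝ := fun t => ∫ x, f t x ^ (q - 2) * A t x ^ 2 ∂circleMeasure with hD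
  have hDnn : ∀ t, 0 ≤ t → 0 ≤ D t := fun t ht => integral_nonneg fun x =>
    mul_nonneg (Real.rpow_nonneg (h.pos t ht x).le _) (sq_nonneg _)
  have hepos : ∀ t, 0 ≤ t → 0 < e t := fun t ht => by
    have hp := h.pos t ht
    simp only [he]
    rw [integral_pos_iff_support_of_nonneg (fun x => (Real.rpow_pos_of_pos (hp x) q).le)
      (integrable_of_continuous (h.continuous_slice_rpow hp q))]
    have : Function.support (fun x => f t x ^ q) = univ :=
      Set.eq_univ_of_forall fun x => (Real.rpow_pos_of_pos (hp x) q).ne'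
    rw [this, measure_univ]
    exact one_pos
  have hed : ∀ t, 0 ≤ t → HasDerivAt e (-(q * (q - 1) * D t)) t := fun t ht =>
    h.hasDerivAt_entropy ht
  have hanti : AntitoneOn e (Ici 0) := by
    refine antitoneOn_of_deriv_nonpos (convex_Ici 0)
      (fun t ht => (hed t ht).continuousAt.continuousWithinAt)
      (fun t ht => (hed t (interior_subset ht)).differentiableAt.differentiableWithinAt) ?_
    intro t ht
    have ht0 : 0 ≤ t := interior_subset ht
    rw [(hed t ht0).deriv]
    have := hDnn t ht0
    have : 0 ≤ q * (q - 1) * D t := mul_nonneg (mul_nonneg hq0.le (by linarith)) this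
    linarith
  have he0 := hepos 0 le_rfl
  -- As the entropy decreases, `e t` may be replaced by `e 0` in the dissipation estimate, which
  -- becomes the autonomous inequality `D' ≤ -2D - cD²`.
  set c : ℝ := q * (2 - q) / 6 / e 0 with hc
  have hcpos : 0 < c := by positivity
  have hDd : ∀ t, 0 ≤ t → ∃ D', HasDerivAt D D' t ∧ D' ≤ -2 * D t - c * D t ^ 2 := fun t ht => by
    refine ⟨_, h.hasDerivAt_fisher ht, ?_⟩
    have hle := fisher_dissipation (h.deriv_f t) (h.deriv_A t) (h.deriv_B t)
      (h.continuous_slice_C t) (h.periodic_f t) (h.periodic_A t) (h.periodic_B t) (h.pos t ht)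
      hq0 hq₂
    refine hle.trans ?_
    have h1 : e t ≤ e 0 := hanti (mem_Ici.2 le_rfl) (mem_Ici.2 ht) ht
    have h2 : c * D t ^ 2 ≤ q * (2 - q) / 6 * D t ^ 2 / e t := by
      rw [hc, div_mul_eq_mul_div]
      exact div_le_div_of_nonneg_left (by positivity) (hepos t ht) h1
    linarith
  -- The differential inequality gives `(log (1 + cD/2))' ≤ -cD`, and `e' = -q(q-1)D`, so `G` is
  -- nondecreasing. Its values are at most `e t ≤ (m + δ t)^q`, which tends to `m^q`.
  set G : ℝ → ℝ := fun t => e t - q * (q - 1) / c * Real.log (1 + c * D t / 2) with hG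
  have hGd : ∀ t, 0 ≤ t → ∃ G', HasDerivAt G G' t ∧ 0 ≤ G' := fun t ht => by
    obtain ⟨D', hD', hle⟩ := hDd t ht
    have hDt := hDnn t ht
    have hlog : 0 < 1 + c * D t / 2 := by positivity
    have d1 : HasDerivAt (fun t => 1 + c * D t / 2) (c * D' / 2) t := by
      have := ((hD'.const_mul c).div_const 2).const_add 1
      exact this
    refine ⟨_, (hed t ht).sub ((d1.log hlog.ne').const_mul (q * (q - 1) / c)), ?_⟩
    have h1 : c * D' / 2 / (1 + c * D t / 2) ≤ -(c * D t) := by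
      rw [div_le_iff₀ hlog]
      have := mul_le_mul_of_nonneg_left hle hcpos.le
      nlinarith
    have h2 : 0 ≤ q * (q - 1) / c :=
      div_nonneg (mul_nonneg hq0.le (by linarith)) hcpos.le
    have h3 := mul_le_mul_of_nonneg_left h1 h2
    have h4 : q * (q - 1) / c * -(c * D t) = -(q * (q - 1) * D t) := by field_simp
    rw [h4] at h3
    linarith
  have hmono : MonotoneOn G (Ici 0) := by
    refine monotoneOn_of_deriv_nonneg (convex_Ici 0) (fun t ht => ?_) (fun t ht => ?_) ?_
    · obtain ⟨_, h1, _⟩ := hGd t ht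
      exact h1.continuousAt.continuousWithinAt
    · obtain ⟨_, h1, _⟩ := hGd t (interior_subset ht)
      exact h1.differentiableAt.differentiableWithinAt
    · intro t ht
      obtain ⟨_, h1, h2⟩ := hGd t (interior_subset ht)
      rwa [h1.deriv]
  obtain ⟨δ, hδ, hb⟩ := h.lim
  have hGle : ∀ t, 0 ≤ t → G 0 ≤ (m + δ t) ^ q := fun t ht => by
    have h1 : G 0 ≤ G t := hmono (mem_Ici.2 le_rfl) (mem_Ici.2 ht) ht
    have h2 : G t ≤ e t := by
      have h3 : 0 ≤ Real.log (1 + c * D t / 2) := Real.log_nonneg (by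
        have := hDnn t ht
        have : 0 ≤ c * D t / 2 := by positivity
        linarith)
      have h4 : 0 ≤ q * (q - 1) / c :=
        div_nonneg (mul_nonneg hq0.le (by linarith)) hcpos.le
      have := mul_nonneg h4 h3
      simp only [hG]
      linarith
    have h5 : e t ≤ (m + δ t) ^ q := by
      have h6 : e t ≤ ∫ _, (m + δ t) ^ q ∂circleMeasure := by
        refine integral_mono (integrable_of_continuous (h.continuous_slice_rpow (h.pos t ht) q))
          (integrable_const _) fun x => ?_
        refine Real.rpow_le_rpow (h.pos t ht x).le ?_ hq0.le
        have := (abs_le.1 (hb t x)).2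
        linarith
      simpa using h6
    linarith
  have hlim : Tendsto (fun t => (m + δ t) ^ q) atTop (𝓝 (m ^ q)) := by
    have h1 : Tendsto (fun t => m + δ t) atTop (𝓝 m) := by simpa using hδ.const_add m
    exact h1.rpow_const (Or.inr hq0.le)
  have hfin : G 0 ≤ m ^ q :=
    ge_of_tendsto hlim (eventually_atTop.2 ⟨0, fun t ht => hGle t ht⟩)
  rw [h.integral_eq_const]
  refine le_trans (le_of_eq ?_) hfin
  simp only [hG]
  have e1 : q * (q - 1) / c = 6 * (q - 1) / (2 - q) * e 0 := by
    rw [hc]; field_simp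
  have e2 : c * D 0 / 2 = q * (2 - q) / 12 * D 0 / e 0 := by
    rw [hc]; field_simp; ring
  rw [e1, e2]

end HeatFlow

/-! ### Explicit heat flows of trigonometric polynomials. -/

/-- The real part of the solution of the heat equation issued from a trigonometric polynomial. -/
noncomputable def heatPoly (s : Finset ℤ) (c : ℤ → ℂ) (t x : ℝ) : ℝ :=
  (trigPoly s (fun k => c k * Complex.exp (-(k : ℂ) ^ 2 * t)) x).re

/-- The coefficients of the derivative of a trigonometric polynomial. -/
noncomputable def derivCoeff (c : ℤ → ℂ) (k : ℤ) : ℂ := c k * (k * Complex.I)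

lemma hasDerivAt_heatPoly (s : Finset ℤ) (c : ℤ → ℂ) (t x : ℝ) :
    HasDerivAt (heatPoly s c t) (heatPoly s (derivCoeff c) t x) x := by
  have h := Complex.reCLM.hasFDerivAt.comp_hasDerivAt x
    (hasDerivAt_trigPoly s (fun k => c k * Complex.exp (-(k : ℂ) ^ 2 * t)) x)
  refine h.congr_deriv ?_
  simp only [heatPoly, derivCoeff, Complex.reCLM_apply]
  congr 2
  funext k
  ring

lemma hasDerivAt_heatPoly_time (s : Finset ℤ) (c : ℤ → ℂ) (t x : ℝ) :
    HasDerivAt (fun t => heatPoly s c t x) (heatPoly s (derivCoeff (derivCoeff c)) t x) t := by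
  have h : HasDerivAt (fun t : ℝ => trigPoly s (fun k => c k * Complex.exp (-(k : ℂ) ^ 2 * t)) x)
      (trigPoly s (fun k => derivCoeff (derivCoeff c) k * Complex.exp (-(k : ℂ) ^ 2 * t)) x) t := by
    unfold trigPoly
    refine HasDerivAt.fun_sum fun k _ => ?_
    have h1 : HasDerivAt (fun t : ℝ => -(k : ℂ) ^ 2 * (t : ℂ)) (-(k : ℂ) ^ 2 * 1) t :=
      ((hasDerivAt_id t).ofReal_comp).const_mul _
    refine ((h1.cexp.const_mul (c k)).mul_const _).congr_deriv ?_
    simp only [derivCoeff]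
    linear_combination (-(c k) * k ^ 2 * Complex.exp (-(k : ℂ) ^ 2 * t) *
      Complex.exp (k * x * Complex.I)) * Complex.I_sq
  exact Complex.reCLM.hasFDerivAt.comp_hasDerivAt t h

lemma continuous_heatPoly (s : Finset ℤ) (c : ℤ → ℂ) :
    Continuous fun z : ℝ × ℝ => heatPoly s c z.1 z.2 := by
  unfold heatPoly trigPoly
  fun_prop

lemma periodic_heatPoly (s : Finset ℤ) (c : ℤ → ℂ) (t : ℝ) :
    Function.Periodic (heatPoly s c t) (2 * Real.pi) := fun x => by
  simp only [heatPoly, periodic_trigPoly s _ x]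

lemma heatPoly_zero (s : Finset ℤ) (c : ℤ → ℂ) (x : ℝ) :
    heatPoly s c 0 x = (trigPoly s c x).re := by
  simp [heatPoly]

/-- The heat flow is a Gaussian average. -/
lemma heatPoly_eq_integral (s : Finset ℤ) (c : ℤ → ℂ) {t : ℝ} (ht : 0 ≤ t) (x : ℝ) :
    heatPoly s c t x =
      ∫ y, (trigPoly s c (x + y)).re ∂(ProbabilityTheory.gaussianReal 0 (2 * t).toNNReal) := by
  set γ := ProbabilityTheory.gaussianReal 0 (2 * t).toNNReal with hγ
  have hint : ∀ k : ℤ, Integrable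
      (fun y : ℝ => c k * Complex.exp (k * ((x + y : ℝ) : ℂ) * Complex.I)) γ := fun k => by
    refine Integrable.of_bound (by fun_prop) ‖c k‖ (ae_of_all _ fun y => ?_)
    rw [norm_mul, show (k : ℂ) * ((x + y : ℝ) : ℂ) * Complex.I
      = ((k * (x + y) : ℝ) : ℂ) * Complex.I by push_cast; ring, Complex.norm_exp_ofReal_mul_I,
      mul_one]
  have hk : ∀ k : ℤ, ∫ y : ℝ, c k * Complex.exp (k * ((x + y : ℝ) : ℂ) * Complex.I) ∂γ =
      c k * Complex.exp (-(k : ℂ) ^ 2 * t) * Complex.exp (k * x * Complex.I) := fun k => by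
    -- With variance `2t` the characteristic function at `k` is `e^{-k² t}`, the heat multiplier of
    -- the `k`-th mode.
    have h1 := ProbabilityTheory.charFun_gaussianReal (μ := 0) (v := (2 * t).toNNReal) (k : ℝ)
    rw [charFun_apply_real, ← hγ] at h1
    have h2 : ∀ y : ℝ, c k * Complex.exp (k * ((x + y : ℝ) : ℂ) * Complex.I) =
        c k * Complex.exp (k * x * Complex.I) * Complex.exp (((k : ℝ) : ℂ) * y * Complex.I) :=
      fun y => by
        rw [mul_assoc (c k), ← Complex.exp_add]
        congr 2
        push_cast
        ring
    simp only [h2]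
    rw [integral_const_mul, h1, mul_right_comm]
    rw [Real.coe_toNNReal _ (by positivity : 0 ≤ 2 * t)]
    congr 3
    push_cast
    ring
  have hsum : Integrable (fun y : ℝ => trigPoly s c (x + y)) γ := by
    unfold trigPoly
    exact integrable_finsetSum _ fun k _ => hint k
  have hre := integral_re (𝕜 := ℂ) hsum
  simp only [RCLike.re_to_complex] at hre
  rw [hre]
  simp only [heatPoly, trigPoly]
  rw [integral_finsetSum _ fun k _ => hint k]
  simp only [hk]

lemma heatPoly_pos {s : Finset ℤ} {c : ℤ → ℂ} (h0 : ∀ x, 0 < (trigPoly s c x).re) {t : ℝ}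
    (ht : 0 ≤ t) (x : ℝ) : 0 < heatPoly s c t x := by
  rw [heatPoly_eq_integral s c ht x]
  have hc : Continuous fun y => (trigPoly s c (x + y)).re :=
    Complex.continuous_re.comp ((continuous_trigPoly s c).comp (by fun_prop))
  rw [integral_pos_iff_support_of_nonneg (fun y => (h0 _).le)]
  · rw [show Function.support (fun y => (trigPoly s c (x + y)).re) = univ from
      Set.eq_univ_of_forall fun y => (h0 _).ne', measure_univ]
    exact one_pos
  · refine Integrable.of_bound hc.aestronglyMeasurable (∑ k ∈ s, ‖c k‖) (ae_of_all _ fun y => ?_)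
    refine (Complex.abs_re_le_norm _).trans ((norm_sum_le _ _).trans (le_of_eq ?_))
    refine Finset.sum_congr rfl fun k _ => ?_
    rw [norm_mul, show (k : ℂ) * ((x + y : ℝ) : ℂ) * Complex.I
      = ((k * (x + y) : ℝ) : ℂ) * Complex.I by push_cast; ring, Complex.norm_exp_ofReal_mul_I,
      mul_one]

/-- Only the zero mode survives as `t → ∞`. The bound is uniform in `x`, as convergence of the
entropy requires. -/
lemma heatPoly_sub_le (s : Finset ℤ) (c : ℤ → ℂ) (t x : ℝ) :
    |heatPoly s c t x - (if 0 ∈ s then c 0 else 0).re| ≤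
      ∑ k ∈ s.erase 0, ‖c k‖ * Real.exp (-(k : ℝ) ^ 2 * t) := by
  have h1 : trigPoly s (fun k => c k * Complex.exp (-(k : ℂ) ^ 2 * t)) x -
      (if 0 ∈ s then c 0 else 0) = ∑ k ∈ s.erase 0,
        c k * Complex.exp (-(k : ℂ) ^ 2 * t) * Complex.exp (k * x * Complex.I) := by
    by_cases h : 0 ∈ s
    · rw [trigPoly, ← Finset.add_sum_erase s _ h, if_pos h]
      simp
    · simp [trigPoly, h]
  rw [heatPoly, ← Complex.sub_re, h1]
  refine (Complex.abs_re_le_norm _).trans ((norm_sum_le _ _).trans (le_of_eq ?_))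
  refine Finset.sum_congr rfl fun k _ => ?_
  rw [norm_mul, norm_mul, show (k : ℂ) * (x : ℂ) * Complex.I
      = ((k * x : ℝ) : ℂ) * Complex.I by push_cast; ring, Complex.norm_exp_ofReal_mul_I,
      mul_one, show -(k : ℂ) ^ 2 * (t : ℂ) = ((-(k : ℝ) ^ 2 * t : ℝ) : ℂ) by push_cast; ring,
      Complex.norm_exp_ofReal]

lemma heatFlow_heatPoly {s : Finset ℤ} {c : ℤ → ℂ} (h0 : ∀ x, 0 < (trigPoly s c x).re) :
    HeatFlow (heatPoly s c) (heatPoly s (derivCoeff c)) (heatPoly s (derivCoeff (derivCoeff c)))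
      (heatPoly s (derivCoeff (derivCoeff (derivCoeff c)))) (if 0 ∈ s then c 0 else 0).re where
  deriv_f := hasDerivAt_heatPoly s c
  deriv_A := hasDerivAt_heatPoly s _
  deriv_B := hasDerivAt_heatPoly s _
  deriv_time := hasDerivAt_heatPoly_time s c
  deriv_time_A := hasDerivAt_heatPoly_time s _
  continuous_f := continuous_heatPoly s c
  continuous_A := continuous_heatPoly s _
  continuous_B := continuous_heatPoly s _
  continuous_C := continuous_heatPoly s _
  periodic_f := periodic_heatPoly s c
  periodic_A := periodic_heatPoly s _
  periodic_B := periodic_heatPoly s _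
  pos := fun _ ht x => heatPoly_pos h0 ht x
  lim := by
    refine ⟨fun t => ∑ k ∈ s.erase 0, ‖c k‖ * Real.exp (-(k : ℝ) ^ 2 * t), ?_,
      heatPoly_sub_le s c⟩
    rw [← Finset.sum_const_zero (s := s.erase 0) (M := ℝ)]
    refine tendsto_finsetSum _ fun k hk => ?_
    have hk0 : (0 : ℝ) < (k : ℝ) ^ 2 := by
      have : (k : ℝ) ≠ 0 := by exact_mod_cast (Finset.mem_erase.1 hk).1
      positivity
    have h1 : Tendsto (fun t : ℝ => -(k : ℝ) ^ 2 * t) atTop atBot :=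
      tendsto_id.const_mul_atTop_of_neg (by linarith)
    simpa using (Real.tendsto_exp_atBot.comp h1).const_mul ‖c k‖

/-- The family of linear inequalities equivalent to the improved entropy inequality. -/
lemma entropy_linear_of_trigPoly {s : Finset ℤ} {c : ℤ → ℂ} (h0 : ∀ x, 0 < (trigPoly s c x).re)
    {q σ : ℝ} (hq₁ : 1 < q) (hq₂ : q < 2) (hσ : 0 ≤ σ) :
    (1 - 6 * (q - 1) / (2 - q) * (Real.log (1 + σ) - σ / (1 + σ))) *
        (∫ x, (trigPoly s c x).re ^ q ∂circleMeasure) ≤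
      q * (q - 1) / 2 / (1 + σ) * (∫ x, (trigPoly s c x).re ^ (q - 2) *
        deriv (fun x => (trigPoly s c x).re) x ^ 2 ∂circleMeasure)
      + (∫ x, (trigPoly s c x).re ∂circleMeasure) ^ q := by
  have H := (heatFlow_heatPoly h0).entropy_le hq₁ hq₂
  have hz : heatPoly s c 0 = fun x => (trigPoly s c x).re := funext fun x => heatPoly_zero s c x
  have hd : ∀ x, heatPoly s (derivCoeff c) 0 x = deriv (fun x => (trigPoly s c x).re) x := fun x => by
    rw [← hz]
    exact (hasDerivAt_heatPoly s c 0 x).deriv.symm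
  simp only [hz, hd] at H
  have hc : Continuous fun x => (trigPoly s c x).re :=
    Complex.continuous_re.comp (continuous_trigPoly s c)
  have hepos : 0 < ∫ x, (trigPoly s c x).re ^ q ∂circleMeasure := by
    rw [integral_pos_iff_support_of_nonneg (fun x => (Real.rpow_pos_of_pos (h0 x) q).le)
      (integrable_of_continuous (hc.rpow_const fun x => Or.inl (h0 x).ne'))]
    rw [show Function.support (fun x => (trigPoly s c x).re ^ q) = univ from
      Set.eq_univ_of_forall fun x => (Real.rpow_pos_of_pos (h0 x) q).ne', measure_univ]
    exact one_pos
  have hDnn : 0 ≤ ∫ x, (trigPoly s c x).re ^ (q - 2) *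
        deriv (fun x => (trigPoly s c x).re) x ^ 2 ∂circleMeasure :=
    integral_nonneg fun x => mul_nonneg (Real.rpow_nonneg (h0 x).le _) (sq_nonneg _)
  set e := ∫ x, (trigPoly s c x).re ^ q ∂circleMeasure
  set D := ∫ x, (trigPoly s c x).re ^ (q - 2) *
        deriv (fun x => (trigPoly s c x).re) x ^ 2 ∂circleMeasure
  have h2q : 0 < 2 - q := by linarith
  have hq1 : 0 < q - 1 := by linarith
  set X := q * (2 - q) / 12 * D / e with hX
  have hXnn : 0 ≤ X := by positivity
  -- The concave logarithm lies below its tangent at `σ`. Multiplying by the entropy then leaves an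
  -- expression linear in the entropy and its production.
  have hlog : Real.log (1 + X) ≤ Real.log (1 + σ) + (X - σ) / (1 + σ) := by
    have h1 := Real.log_le_sub_one_of_pos (x := (1 + X) / (1 + σ)) (by positivity)
    rw [Real.log_div (by positivity) (by positivity)] at h1
    have h2 : (1 + X) / (1 + σ) - 1 = (X - σ) / (1 + σ) := by field_simp; ring
    linarith
  have hk : 0 ≤ 6 * (q - 1) / (2 - q) * e := by positivity
  have h3 := mul_le_mul_of_nonneg_left hlog hk
  have h4 : 6 * (q - 1) / (2 - q) * e * (Real.log (1 + σ) + (X - σ) / (1 + σ)) =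
      6 * (q - 1) / (2 - q) * (Real.log (1 + σ) - σ / (1 + σ)) * e
        + q * (q - 1) / 2 / (1 + σ) * D := by
    rw [hX]
    field_simp
    ring
  rw [h4] at h3
  linarith

/-! ### From trigonometric polynomials to Beckner's inequality in `H¹`. -/

lemma IsSmoothPos.continuous_rpow {f : ℝ → ℝ} (hf : IsSmoothPos f) (r : ℝ) :
    Continuous fun x => f x ^ r :=
  hf.continuous.rpow_const fun x => Or.inl (hf.pos x).ne'

/-- The family of linear inequalities equivalent to the improved entropy inequality, for smooth
positive functions. -/
lemma IsSmoothPos.entropy_linear {f : ℝ → ℝ} (hf : IsSmoothPos f) {q σ : ℝ} (hq₁ : 1 < q)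
    (hq₂ : q < 2) (hσ : 0 ≤ σ) :
    (1 - 6 * (q - 1) / (2 - q) * (Real.log (1 + σ) - σ / (1 + σ))) *
        (∫ x, f x ^ q ∂circleMeasure) ≤
      q * (q - 1) / 2 / (1 + σ) * (∫ x, f x ^ (q - 2) * deriv f x ^ 2 ∂circleMeasure)
      + (∫ x, f x ∂circleMeasure) ^ q := by
  have hq0 : 0 < q := by linarith
  have hq1 : 0 < q - 1 := by linarith
  set α := 1 - 6 * (q - 1) / (2 - q) * (Real.log (1 + σ) - σ / (1 + σ))
  set β := q * (q - 1) / 2 / (1 + σ) with hβ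
  have hβ0 : 0 ≤ β := by positivity
  have hcf := hf.continuous
  have hcf' := hf.continuous_deriv
  have he : 0 ≤ ∫ x, f x ^ q ∂circleMeasure :=
    integral_nonneg fun x => Real.rpow_nonneg (hf.pos x).le _
  have hm : 0 ≤ ∫ x, f x ∂circleMeasure := integral_nonneg fun x => (hf.pos x).le
  have hD : 0 ≤ ∫ x, f x ^ (q - 2) * deriv f x ^ 2 ∂circleMeasure :=
    integral_nonneg fun x => mul_nonneg (Real.rpow_nonneg (hf.pos x).le _) (sq_nonneg _)
  -- For `α ≤ 0` the claim is a matter of signs. Otherwise `α > 0` lets the pointwise bound `f ≤ T`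
  -- pass to the left-hand side.
  rcases le_or_gt α 0 with hα | hα
  · have h1 : α * (∫ x, f x ^ q ∂circleMeasure) ≤ 0 := mul_nonpos_of_nonpos_of_nonneg hα he
    have h2 := mul_nonneg hβ0 hD
    have h3 := Real.rpow_nonneg hm q
    linarith
  set w : ℝ → ℝ := fun x => f x ^ ((q - 2) / 2) with hw
  have hwc : Continuous w := hf.continuous_rpow _
  have hw2 : ∀ x, f x ^ (q - 2) = w x ^ 2 := fun x => by
    simp only [hw]
    rw [← Real.rpow_mul_natCast (hf.pos x).le]
    congr 1
    push_cast
    ring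
  obtain ⟨M, hM⟩ := (isCompact_Icc (a := (0 : ℝ)) (b := 2 * Real.pi)).exists_bound_of_continuousOn
    hwc.continuousOn
  have hM0 : 0 ≤ M := (norm_nonneg _).trans (hM 0 ⟨le_rfl, Real.two_pi_pos.le⟩)
  have hsq : ∀ g : ℝ → ℝ, Continuous g →
      ∫ x, f x ^ (q - 2) * g x ^ 2 ∂circleMeasure = lqNorm 2 (fun x => w x * g x) ^ 2 := by
    intro g hg
    have hwg : Continuous fun x => w x * g x := hwc.mul hg
    rw [MagneticRing.lqNorm_two_sq (memLp_of_continuous hwg 2)]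
    refine integral_congr_ae (ae_of_all _ fun x => ?_)
    simp only
    rw [hw2, Real.norm_eq_abs, sq_abs, mul_pow]
  set K := lqNorm 2 (fun x => w x * deriv f x) with hK
  have hK0 : 0 ≤ K := lqNorm_nonneg _ _
  have main : ∀ ε : ℝ, 0 < ε → α * (∫ x, f x ^ q ∂circleMeasure) ≤
      β * (K + M * ε) ^ 2 + ((∫ x, f x ∂circleMeasure) + 2 * ε) ^ q := by
    intro ε hε
    -- Approximating `f + ε` within `ε` gives `f ≤ T ≤ f + 2ε`. The lower bound yields positivity of
    -- `T` and, as `q < 2`, also `T^(q-2) ≤ f^(q-2)`.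
    have hfε : MemH1 fun x => f x + ε :=
      memH1_of_contDiff (hf.contDiff.add contDiff_const) fun x => by simp [hf.periodic x]
    obtain ⟨s, c, h1, h2⟩ := hfε.exists_trigPoly_re hε
    set T : ℝ → ℝ := fun x => (trigPoly s c x).re with hT
    have hTc : ContDiff ℝ 1 T := Complex.reCLM.contDiff.comp (contDiff_trigPoly s c)
    have hTf : ∀ x, f x ≤ T x := fun x => by have := (abs_le.1 (h1 x)).1; linarith
    have hTf' : ∀ x, T x ≤ f x + 2 * ε := fun x => by have := (abs_le.1 (h1 x)).2; linarith
    have hT0 : ∀ x, 0 < T x := fun x => (hf.pos x).trans_le (hTf x)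
    have hTs : IsSmoothPos T := ⟨hTc, fun x => by simp [hT, periodic_trigPoly s c x], hT0⟩
    have hcT' := hTs.continuous_deriv
    simp only [deriv_add_const] at h2
    have H := entropy_linear_of_trigPoly hT0 hq₁ hq₂ hσ
    have e1 : α * (∫ x, f x ^ q ∂circleMeasure) ≤ α * ∫ x, T x ^ q ∂circleMeasure := by
      refine mul_le_mul_of_nonneg_left (integral_mono (integrable_of_continuous (hf.continuous_rpow q))
        (integrable_of_continuous (hTs.continuous_rpow q)) fun x => ?_) hα.le
      exact Real.rpow_le_rpow (hf.pos x).le (hTf x) hq0.le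
    have e2 : ∫ x, T x ^ (q - 2) * deriv T x ^ 2 ∂circleMeasure ≤ (K + M * ε) ^ 2 := by
      have i1 : ∫ x, T x ^ (q - 2) * deriv T x ^ 2 ∂circleMeasure ≤
          ∫ x, f x ^ (q - 2) * deriv T x ^ 2 ∂circleMeasure := by
        refine integral_mono
          (integrable_of_continuous ((hTs.continuous_rpow _).mul (hcT'.pow 2)))
          (integrable_of_continuous ((hf.continuous_rpow _).mul (hcT'.pow 2))) fun x => ?_
        exact mul_le_mul_of_nonneg_right
          (Real.rpow_le_rpow_of_nonpos (hf.pos x) (hTf x) (by linarith)) (sq_nonneg _)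
      rw [hsq _ hcT'] at i1
      refine i1.trans (pow_le_pow_left₀ (lqNorm_nonneg _ _) ?_ 2)
      have i2 : (fun x => w x * deriv T x) =
          fun x => w x * deriv f x + w x * (deriv T x - deriv f x) := by funext x; ring
      rw [i2]
      refine (lqNorm_add_le (by norm_num) (memLp_of_continuous (hwc.mul hcf') 2)
        (memLp_of_continuous (hwc.mul (hcT'.sub hcf')) 2)).trans (add_le_add le_rfl ?_)
      have i3 : lqNorm 2 (fun x => w x * (deriv T x - deriv f x)) ≤
          lqNorm 2 (fun x => M * (deriv T x - deriv f x)) := by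
        refine lqNorm_mono (memLp_of_continuous (continuous_const.mul (hcT'.sub hcf')) 2)
          (ae_circleMeasure_of_forall_Ioc fun x hx => ?_)
        rw [norm_mul, norm_mul, Real.norm_of_nonneg hM0]
        exact mul_le_mul_of_nonneg_right (hM x ⟨hx.1.le, hx.2⟩) (norm_nonneg _)
      rw [lqNorm_const_mul, Real.norm_of_nonneg hM0] at i3
      exact i3.trans (mul_le_mul_of_nonneg_left h2 hM0)
    have e3 : (∫ x, T x ∂circleMeasure) ^ q ≤ ((∫ x, f x ∂circleMeasure) + 2 * ε) ^ q := by
      refine Real.rpow_le_rpow (integral_nonneg fun x => (hT0 x).le) ?_ hq0.le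
      have i1 : ∫ x, T x ∂circleMeasure ≤ ∫ x, (f x + 2 * ε) ∂circleMeasure :=
        integral_mono (integrable_of_continuous hTs.continuous)
          ((integrable_of_continuous hcf).add (integrable_const _)) hTf'
      rw [integral_add (integrable_of_continuous hcf) (integrable_const _)] at i1
      simpa using i1
    have e4 := mul_le_mul_of_nonneg_left e2 hβ0
    exact e1.trans (H.trans (add_le_add e4 e3))
  rw [hsq _ hcf']
  have hlim : Tendsto (fun ε : ℝ => β * (K + M * ε) ^ 2 +
      ((∫ x, f x ∂circleMeasure) + 2 * ε) ^ q) (𝓝[>] 0)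
      (𝓝 (β * K ^ 2 + (∫ x, f x ∂circleMeasure) ^ q)) := by
    have hc : Continuous fun ε : ℝ => β * (K + M * ε) ^ 2 +
        ((∫ x, f x ∂circleMeasure) + 2 * ε) ^ q := by
      refine Continuous.add (by fun_prop) ?_
      exact (by fun_prop : Continuous fun ε : ℝ => (∫ x, f x ∂circleMeasure) + 2 * ε).rpow_const
        fun _ => Or.inr hq0.le
    have := (hc.tendsto 0).mono_left (nhdsWithin_le_nhds (s := Ioi 0))
    simpa using this
  exact ge_of_tendsto hlim (by filter_upwards [self_mem_nhdsWithin] with ε hε using main ε hε)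

/-- Improved Beckner interpolation inequality for smooth positive functions, in linearized form. -/
lemma IsSmoothPos.beckner_linear {v : ℝ → ℝ} (hv : IsSmoothPos v) {p σ : ℝ} (hp₁ : 1 < p)
    (hp₂ : p < 2) (hσ : 0 ≤ σ) :
    (1 - 3 * (2 - p) / (p - 1) * (Real.log (1 + σ) - σ / (1 + σ))) * lqNorm 2 v ^ 2 ≤
      (2 - p) / (1 + σ) * lqNorm 2 (deriv v) ^ 2 + lqNorm (ENNReal.ofReal p) v ^ 2 := by
  have hp0 : 0 < p := by linarith
  -- With `f = v^p` and `q = 2/p` one has `f^q = v²` and `f^(q-2) f'² = p² v'²`, while `q(q-1)p²/2 =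
  -- 2 - p`.
  have hf : IsSmoothPos fun x => v x ^ p :=
    ⟨hv.contDiff.rpow_const_of_ne fun x => (hv.pos x).ne', fun x => by simp [hv.periodic x],
      fun x => Real.rpow_pos_of_pos (hv.pos x) p⟩
  have hq₁ : 1 < 2 / p := by rw [lt_div_iff₀ hp0]; linarith
  have hq₂ : 2 / p < 2 := by rw [div_lt_iff₀ hp0]; linarith
  have H := hf.entropy_linear hq₁ hq₂ hσ
  have hp1 : p - 1 ≠ 0 := by linarith
  have e1 : 6 * (2 / p - 1) / (2 - 2 / p) = 3 * (2 - p) / (p - 1) := by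
    have : 2 - 2 / p ≠ 0 := by linarith
    have : 2 * p - 2 ≠ 0 := by linarith
    have h3 : 2 - 2 / p = 2 * (p - 1) / p := by field_simp
    rw [h3]
    field_simp
    ring
  have e2 : ∀ x, (v x ^ p) ^ (2 / p) = v x ^ 2 := fun x => by
    rw [← Real.rpow_mul (hv.pos x).le, mul_div_cancel₀ _ hp0.ne', Real.rpow_two]
  have e3 : ∀ x, (v x ^ p) ^ (2 / p - 2) * deriv (fun x => v x ^ p) x ^ 2 =
      p ^ 2 * deriv v x ^ 2 := fun x => by
    have hx := hv.pos x
    rw [(hasDerivAt_rpow hv.hasDerivAt hv.pos p x).deriv, ← Real.rpow_mul hx.le, mul_pow, mul_pow,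
      ← Real.rpow_mul_natCast hx.le (p - 1) 2]
    have : v x ^ (p * (2 / p - 2)) * v x ^ ((p - 1) * ((2 : ℕ) : ℝ)) = 1 := by
      have e : p * (2 / p - 2) + (p - 1) * ((2 : ℕ) : ℝ) = 0 := by
        push_cast
        field_simp
        ring
      rw [← Real.rpow_add hx, e, Real.rpow_zero]
    linear_combination (p ^ 2 * deriv v x ^ 2) * this
  simp only [e1, e2, e3] at H
  rw [integral_const_mul, ← hv.lqNorm_two_sq, ← hv.lqNorm_deriv_sq] at H
  have e4 : lqNorm (ENNReal.ofReal p) v ^ 2 = (∫ x, v x ^ p ∂circleMeasure) ^ (2 / p) := by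
    rw [lqNorm_sq_of_continuous hv.continuous hp0]
    simp only [Real.norm_of_nonneg (hv.pos _).le]
  rw [e4]
  refine H.trans (le_of_eq ?_)
  congr 1
  field_simp

lemma MemH1.beckner_linear {u : ℝ → ℝ} (hu : MemH1 u) {p σ : ℝ} (hp₁ : 1 < p)
    (hp₂ : p < 2) (hσ : 0 ≤ σ) :
    (1 - 3 * (2 - p) / (p - 1) * (Real.log (1 + σ) - σ / (1 + σ))) * lqNorm 2 u ^ 2 ≤
      (2 - p) / (1 + σ) * lqNorm 2 (deriv u) ^ 2 + lqNorm (ENNReal.ofReal p) u ^ 2 := by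
  have h2p : 0 < 2 - p := by linarith
  have := MemH1.inequality_of_isSmoothPos (p := p) (β := (2 - p) / (1 + σ)) (γ := 0) (δ := 1)
    hp₁.le (by positivity) le_rfl
    (fun v hv => by simpa using hv.beckner_linear hp₁ hp₂ hσ) hu
  simpa using this

/-- Beckner's interpolation inequality on the circle. -/
lemma MemH1.beckner {u : ℝ → ℝ} (hu : MemH1 u) {p : ℝ} (hp₁ : 1 < p) (hp₂ : p < 2) :
    lqNorm 2 u ^ 2 ≤ (2 - p) * lqNorm 2 (deriv u) ^ 2 + lqNorm (ENNReal.ofReal p) u ^ 2 := by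
  simpa using hu.beckner_linear hp₁ hp₂ le_rfl

/-- Beckner's interpolation inequality is strict unless the derivative vanishes. -/
lemma MemH1.beckner_strict {u : ℝ → ℝ} (hu : MemH1 u) {p : ℝ} (hp₁ : 1 < p) (hp₂ : p < 2)
    (hJ : 0 < lqNorm 2 (deriv u) ^ 2) :
    lqNorm 2 u ^ 2 < (2 - p) * lqNorm 2 (deriv u) ^ 2 + lqNorm (ENNReal.ofReal p) u ^ 2 := by
  have h2p : 0 < 2 - p := by linarith
  have hp1 : 0 < p - 1 := by linarith
  set N := lqNorm 2 u ^ 2 with hN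
  set J := lqNorm 2 (deriv u) ^ 2
  have hNp : 0 ≤ lqNorm (ENNReal.ofReal p) u ^ 2 := sq_nonneg _
  rcases (sq_nonneg (lqNorm 2 u)).eq_or_lt with h | h
  · rw [← hN] at h
    rw [← h]
    positivity
  rw [← hN] at h
  set k := 3 * (2 - p) / (p - 1) with hk
  have hk0 : 0 < k := by positivity
  -- For this `σ` the linear inequality reads `N ≤ k N log(1 + σ) + ‖u‖_p²`, while `k N σ = (2-p)
  -- J`. Strictness is then `log(1 + σ) < σ`.
  set σ := (2 - p) * J / (k * N) with hσ
  have hσ0 : 0 < σ := by positivity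
  have H := hu.beckner_linear hp₁ hp₂ hσ0.le
  have e : (2 - p) * J = k * N * σ := by rw [hσ]; field_simp
  have hlog : Real.log (1 + σ) < σ := by
    have := Real.log_lt_sub_one_of_pos (x := 1 + σ) (by positivity) (by linarith)
    linarith
  have e2 : (2 - p) / (1 + σ) * J = k * N * (σ / (1 + σ)) := by
    rw [div_mul_eq_mul_div, e, mul_div_assoc]
  have h1 := mul_lt_mul_of_pos_left hlog (mul_pos hk0 h)
  change (1 - k * (Real.log (1 + σ) - σ / (1 + σ))) * N ≤ _ at H
  rw [e2] at H
  rw [e]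
  linarith

lemma MemH1.critical_inequality {u : ℝ → ℝ} (hu : MemH1 u) :
    lqNorm 2 u ^ 2 ≤ 4 * lqNorm 2 (deriv u) ^ 2 + invNormInvSq u := by
  have := MemH1.inequality_of_isSmoothPos (p := 1) (α := 1) (β := 4) (γ := 1) (δ := 0)
    le_rfl (by norm_num) zero_le_one (fun v hv => by simpa using hv.critical_inequality) hu
  simpa using this

/-! ### Instability of the constants -/

/-- Second order upper bound for `(1 + x) ^ p` near `x = 0`. -/
lemma one_add_rpow_le {p d x : ℝ} (hp₁ : 1 < p) (hp₂ : p < 2) (hd : 0 < d)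
    (hx : |x| ≤ d / (1 + d)) : (1 + x) ^ p ≤ 1 + p * x + p * (p - 1 + d) / 2 * x ^ 2 := by
  have hr1 : d / (1 + d) < 1 := by rw [div_lt_one (by linarith)]; linarith
  set r := d / (1 + d) with hr
  have hr0 : 0 < r := by positivity
  have hrd : r * (1 + d) = d := by rw [hr]; field_simp
  set g : ℝ → ℝ := fun x => 1 + p * x + p * (p - 1 + d) / 2 * x ^ 2 - (1 + x) ^ p with hg
  have hgd : ∀ y, -1 < y →
      HasDerivAt g (p * (1 + (p - 1 + d) * y - (1 + y) ^ (p - 1))) y := fun y hy => by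
    have h0 : HasDerivAt (fun y : ℝ => 1 + y) 1 y := (hasDerivAt_id y).const_add 1
    have h1 : HasDerivAt (fun y : ℝ => (1 + y) ^ p) (1 * p * (1 + y) ^ (p - 1)) y :=
      h0.rpow_const (Or.inl (by linarith : 1 + y ≠ 0))
    have h2 : HasDerivAt (fun y : ℝ => 1 + p * y) (p * 1) y :=
      ((hasDerivAt_id y).const_mul p).const_add 1
    have h3 : HasDerivAt (fun y : ℝ => p * (p - 1 + d) / 2 * y ^ 2)
        (p * (p - 1 + d) / 2 * (2 * y)) y := by
      simpa using (hasDerivAt_pow 2 y).const_mul (p * (p - 1 + d) / 2)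
    refine ((h2.add h3).sub h1).congr_deriv ?_
    ring
  have hg0 : g 0 = 0 := by simp [hg]
  suffices 0 ≤ g x by simp only [hg] at this; linarith
  have hx' := abs_le.1 hx
  rcases le_total 0 x with h | h
  · have hmono : MonotoneOn g (Icc 0 r) := by
      refine monotoneOn_of_deriv_nonneg (convex_Icc 0 r)
        (fun y hy => (hgd y (by linarith [hy.1])).continuousAt.continuousWithinAt)
        (fun y hy => (hgd y (by linarith [(interior_subset hy).1])).differentiableAt.differentiableWithinAt)
        fun y hy => ?_
      have hy0 : 0 ≤ y := (interior_subset hy).1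
      rw [(hgd y (by linarith)).deriv]
      have hb := rpow_one_add_le_one_add_mul_self (s := y) (by linarith)
        (p := p - 1) (by linarith) (by linarith)
      have : 0 ≤ d * y := by positivity
      exact mul_nonneg (by linarith) (by linarith)
    rw [← hg0]
    exact hmono ⟨le_rfl, hr0.le⟩ ⟨h, hx'.2⟩ h
  · have hanti : AntitoneOn g (Icc (-r) 0) := by
      refine antitoneOn_of_deriv_nonpos (convex_Icc (-r) 0)
        (fun y hy => (hgd y (by linarith [hy.1])).continuousAt.continuousWithinAt)
        (fun y hy => (hgd y (by linarith [(interior_subset hy).1])).differentiableAt.differentiableWithinAt)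
        fun y hy => ?_
      have hy0 : y ≤ 0 := (interior_subset hy).2
      have hyr : -r ≤ y := (interior_subset hy).1
      have hy1 : 0 < 1 + y := by linarith
      rw [(hgd y (by linarith)).deriv]
      refine mul_nonpos_of_nonneg_of_nonpos (by linarith) ?_
      -- For `y ≤ 0` a lower bound on `(1 + y)^(p-1)` is needed, so Bernoulli's inequality is
      -- applied to the reciprocal `(1 + y)⁻¹`. The radius `d / (1 + d)` is what absorbs the
      -- quadratic remainder.
      have hb := rpow_one_add_le_one_add_mul_self (s := -y / (1 + y))
        (by rw [le_div_iff₀ hy1]; linarith) (p := p - 1) (by linarith) (by linarith)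
      have e1 : 1 + -y / (1 + y) = (1 + y)⁻¹ := by field_simp; ring
      rw [e1, Real.inv_rpow hy1.le] at hb
      set z := (1 + y) ^ (p - 1) with hz
      have hz0 : 0 < z := Real.rpow_pos_of_pos hy1 _
      have e2 : 1 + (p - 1) * (-y / (1 + y)) = (1 + (2 - p) * y) / (1 + y) := by field_simp; ring
      rw [e2, inv_le_comm₀ hz0 (by apply div_pos _ hy1; nlinarith), inv_div] at hb
      have hden : 0 < 1 + (2 - p) * y := by nlinarith
      have h3 : 1 + (p - 1 + d) * y ≤ (1 + y) / (1 + (2 - p) * y) := by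
        rw [le_div_iff₀ hden]
        have h4 : (p - 1 + d) * (2 - p) * (-y) ≤ d := by
          have : (p - 1 + d) * (2 - p) ≤ 1 + d := by nlinarith
          have h6 : (p - 1 + d) * (2 - p) * (-y) ≤ (1 + d) * (-y) :=
            mul_le_mul_of_nonneg_right this (by linarith)
          nlinarith
        nlinarith
      linarith
    rw [← hg0]
    exact hanti ⟨hx'.1, h⟩ ⟨by linarith, le_rfl⟩ h

lemma integral_cos_pow : (∫ x, Real.cos x ∂circleMeasure = 0) ∧
    (∫ x, Real.cos x ^ 2 ∂circleMeasure = 1 / 2) ∧ ∫ x, Real.cos x ^ 3 ∂circleMeasure = 0 := by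
  refine ⟨integral_deriv_eq_zero_of_periodic Real.hasDerivAt_sin Real.continuous_cos
    Real.sin_periodic, ?_, ?_⟩
  · have h := integral_deriv_eq_zero_of_periodic (F := fun x => Real.sin x * Real.cos x)
      (f := fun x => 2 * Real.cos x ^ 2 - 1) (fun x => by
        refine ((Real.hasDerivAt_sin x).mul (Real.hasDerivAt_cos x)).congr_deriv ?_
        have := Real.sin_sq_add_cos_sq x
        linear_combination -this) (by fun_prop) (fun x => by simp)
    rw [integral_sub (integrable_of_continuous (by fun_prop)) (integrable_const _),
      integral_const_mul] at h
    simp only [integral_const, probReal_univ, one_smul] at h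
    linarith
  · refine integral_deriv_eq_zero_of_periodic (F := fun x => Real.sin x - Real.sin x ^ 3 / 3)
      (fun x => ?_) (by fun_prop) (fun x => by simp)
    refine ((Real.hasDerivAt_sin x).sub (((Real.hasDerivAt_sin x).pow 3).div_const 3)).congr_deriv ?_
    have := Real.sin_sq_add_cos_sq x
    push_cast
    linear_combination (-Real.cos x) * this

lemma integral_cos_poly (α β γ δ : ℝ) :
    ∫ x, (α + β * Real.cos x + γ * Real.cos x ^ 2 + δ * Real.cos x ^ 3) ∂circleMeasure
      = α + γ / 2 := by
  obtain ⟨h1, h2, h3⟩ := integral_cos_pow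
  have i1 : Integrable (fun x => β * Real.cos x + γ * Real.cos x ^ 2 + δ * Real.cos x ^ 3)
      circleMeasure := integrable_of_continuous (by fun_prop)
  have e : (fun x => α + β * Real.cos x + γ * Real.cos x ^ 2 + δ * Real.cos x ^ 3) =
      fun x => α + (β * Real.cos x + γ * Real.cos x ^ 2 + δ * Real.cos x ^ 3) := by
    funext x; ring
  rw [e, integral_add (integrable_const _) i1, integral_lin_comb
    (integrable_of_continuous (by fun_prop)) (integrable_of_continuous (by fun_prop))
    (integrable_of_continuous (by fun_prop)), h1, h2, h3]
  simp
  ring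

/-- The energy of a small perturbation of the constant function by a first harmonic. -/
lemma scalarEnergy_one_add_cos_le {a p μ d ε : ℝ} (hp₁ : 1 < p) (hp₂ : p < 2) (hμ : 0 < μ)
    (hd : 0 < d) (hε : 0 < ε) (hεd : ε ≤ d / (1 + d)) :
    IsSmoothPos (fun x => 1 + ε * Real.cos x) ∧
    lqNorm 2 (fun x => 1 + ε * Real.cos x) ^ 2 = 1 + ε ^ 2 / 2 ∧
    scalarEnergy a p μ (fun x => 1 + ε * Real.cos x) ≤
      ε ^ 2 / 2 + a ^ 2 * (1 - 3 / 2 * ε ^ 2 + 9 / 4 * ε ^ 4)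
        + μ * (1 + (p - 1 + d) / 2 * ε ^ 2 + (1 + d) ^ 2 * ε ^ 4) := by
  have hε1 : ε < 1 := hεd.trans_lt (by rw [div_lt_one (by linarith)]; linarith)
  have habs : ∀ x, |ε * Real.cos x| ≤ ε := fun x => by
    rw [abs_mul, abs_of_pos hε]
    have := Real.abs_cos_le_one x
    nlinarith
  set u : ℝ → ℝ := fun x => 1 + ε * Real.cos x with hu
  have hpos : ∀ x, 0 < u x := fun x => by
    have := (abs_le.1 (habs x)).1
    simp only [hu]
    linarith
  have hsm : IsSmoothPos u :=
    ⟨contDiff_const.add (contDiff_const.mul Real.contDiff_cos), fun x => by simp [hu], hpos⟩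
  have hder : ∀ x, deriv u x = -(ε * Real.sin x) := fun x => by
    have := ((Real.hasDerivAt_cos x).const_mul ε).const_add 1
    have h2 : HasDerivAt u (ε * -Real.sin x) x := this
    rw [h2.deriv]
    ring
  have hJ : ∫ x, deriv u x ^ 2 ∂circleMeasure = ε ^ 2 / 2 := by
    have : ∀ x, deriv u x ^ 2 = ε ^ 2 + 0 * Real.cos x + (-ε ^ 2) * Real.cos x ^ 2
        + 0 * Real.cos x ^ 3 := fun x => by
      rw [hder x]
      have := Real.sin_sq_add_cos_sq x
      linear_combination ε ^ 2 * this
    simp only [this]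
    rw [integral_cos_poly]
    ring
  have hN : lqNorm 2 u ^ 2 = 1 + ε ^ 2 / 2 := by
    have : ∀ x, u x ^ 2 = 1 + (2 * ε) * Real.cos x + ε ^ 2 * Real.cos x ^ 2
        + 0 * Real.cos x ^ 3 := fun x => by simp only [hu]; ring
    rw [hsm.lqNorm_two_sq]
    simp only [this]
    rw [integral_cos_poly]
  refine ⟨hsm, hN, ?_⟩
  have hV : 1 + 3 / 2 * ε ^ 2 ≤ ∫ x, (u x ^ 2)⁻¹ ∂circleMeasure := by
    have h1 : ∫ x, (1 + (-2 * ε) * Real.cos x + (3 * ε ^ 2) * Real.cos x ^ 2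
        + (-4 * ε ^ 3) * Real.cos x ^ 3) ∂circleMeasure ≤ ∫ x, (u x ^ 2)⁻¹ ∂circleMeasure := by
      refine integral_mono (integrable_of_continuous (by fun_prop))
        (integrable_of_continuous hsm.continuous_inv_sq) fun x => ?_
      have hx := hpos x
      have hy := (abs_le.1 (habs x)).1
      simp only
      rw [← one_div, le_div_iff₀ (by positivity)]
      simp only [hu]
      set y := ε * Real.cos x with hydef
      -- The cubic Taylor polynomial of `(1 + y)⁻²` is a global lower bound here, since `5 + 4y > 0`
      -- for `|y| < 1`.
      have e : (1 + (-2 * ε) * Real.cos x + (3 * ε ^ 2) * Real.cos x ^ 2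
        + (-4 * ε ^ 3) * Real.cos x ^ 3) * (1 + y) ^ 2 = 1 - y ^ 4 * (5 + 4 * y) := by
        rw [hydef]; ring
      rw [e]
      have : 0 ≤ y ^ 4 * (5 + 4 * y) := mul_nonneg (by positivity) (by linarith)
      linarith
    rw [integral_cos_poly] at h1
    linarith
  have hinv : (∫ x, (u x ^ 2)⁻¹ ∂circleMeasure)⁻¹ ≤ 1 - 3 / 2 * ε ^ 2 + 9 / 4 * ε ^ 4 := by
    refine (inv_anti₀ (by positivity) hV).trans ?_
    rw [inv_le_iff_one_le_mul₀ (by positivity)]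
    nlinarith [pow_pos hε 6]
  have hNp : lqNorm (ENNReal.ofReal p) u ^ 2 ≤
      1 + (p - 1 + d) / 2 * ε ^ 2 + (1 + d) ^ 2 * ε ^ 4 := by
    rw [lqNorm_sq_of_continuous hsm.continuous (by linarith)]
    simp only [Real.norm_of_nonneg (hpos _).le]
    have h1 : ∫ x, u x ^ p ∂circleMeasure ≤ ∫ x, (1 + (p * ε) * Real.cos x
        + (p * (p - 1 + d) / 2 * ε ^ 2) * Real.cos x ^ 2 + 0 * Real.cos x ^ 3) ∂circleMeasure := by
      refine integral_mono (integrable_of_continuous (hsm.continuous_rpow p))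
        (integrable_of_continuous (by fun_prop)) fun x => ?_
      have := one_add_rpow_le hp₁ hp₂ hd ((habs x).trans hεd)
      refine this.trans (le_of_eq ?_)
      ring
    rw [integral_cos_poly] at h1
    set Y := p * (p - 1 + d) / 2 * ε ^ 2 / 2 with hY
    have hpd : 0 < p - 1 + d := by linarith
    have hY0 : 0 ≤ Y := by positivity
    have hq1 : 1 < 2 / p := by rw [lt_div_iff₀ (by linarith)]; linarith
    have hq2 : 2 / p < 2 := by rw [div_lt_iff₀ (by linarith)]; linarith
    have h2 : (∫ x, u x ^ p ∂circleMeasure) ^ (2 / p) ≤ (1 + Y) ^ (2 / p) :=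
      Real.rpow_le_rpow (integral_nonneg fun x => Real.rpow_nonneg (hpos x).le _) h1 (by linarith)
    -- One factor `1 + Y` is split off so that the remaining exponent `2/p - 1` lies in `[0, 1]`,
    -- where Bernoulli's inequality gives an upper bound.
    have h3 : (1 + Y) ^ (2 / p) ≤ (1 + Y) * (1 + (2 / p - 1) * Y) := by
      have hb := rpow_one_add_le_one_add_mul_self (s := Y) (by linarith)
        (p := 2 / p - 1) (by linarith) (by linarith)
      have : (1 + Y) ^ (2 / p) = (1 + Y) * (1 + Y) ^ (2 / p - 1) := by
        rw [← Real.rpow_one_add' (by linarith) (by linarith)]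
        congr 1
        ring
      rw [this]
      exact mul_le_mul_of_nonneg_left hb (by linarith)
    have h4 : 2 / p * Y = (p - 1 + d) / 2 * ε ^ 2 := by
      rw [hY]
      have : p ≠ 0 := by linarith
      field_simp
    have h5 : Y ≤ (1 + d) * ε ^ 2 := by
      rw [hY]
      have h6 : p * (p - 1 + d) ≤ 2 * (1 + d) := by nlinarith
      nlinarith [sq_nonneg ε]
    have h7 : Y ^ 2 ≤ (1 + d) ^ 2 * ε ^ 4 := by
      have := pow_le_pow_left₀ hY0 h5 2
      nlinarith
    nlinarith [sq_nonneg Y]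
  rw [scalarEnergy_eq a p μ hsm, hJ]
  have e1 := mul_le_mul_of_nonneg_left hinv (sq_nonneg a)
  have e2 := mul_le_mul_of_nonneg_left hNp hμ.le
  linarith

/-- Above the threshold, a perturbation by a first harmonic lowers the energy. -/
lemma exists_scalarEnergy_lt {a p μ : ℝ} (hp₁ : 1 < p) (hp₂ : p < 2) (hμ : 0 < μ)
    (h : 1 < μ * (2 - p) + 4 * a ^ 2) :
    ∃ u : ℝ → ℝ, MemH1 u ∧ 0 < lqNorm 2 u ^ 2 ∧
      scalarEnergy a p μ u < (a ^ 2 + μ) * lqNorm 2 u ^ 2 := by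
  set η := μ * (2 - p) + 4 * a ^ 2 - 1 with hη
  have hη0 : 0 < η := by linarith
  -- The second-order coefficient of the energy gap is `(-η + μ d) / 2`, which equals `-η / 4` for
  -- this `d`. The fourth-order remainder `K ε⁴` is then kept below `η ε² / 4`.
  set d := η / (2 * μ) with hd
  have hd0 : 0 < d := by positivity
  have hμd : μ * d = η / 2 := by rw [hd]; field_simp
  set K := 9 / 4 * a ^ 2 + μ * (1 + d) ^ 2 with hK
  have hK0 : 0 < K := by positivity
  have hev : ∀ᶠ ε : ℝ in 𝓝[>] 0, ε < d / (1 + d) ∧ K * ε ^ 2 < η / 4 := by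
    have hc : Continuous fun ε : ℝ => K * ε ^ 2 := by fun_prop
    have h1 : ∀ᶠ ε : ℝ in 𝓝 0, K * ε ^ 2 < η / 4 :=
      hc.continuousAt.eventually (gt_mem_nhds (by simpa using hη0))
    have h2 : ∀ᶠ ε : ℝ in 𝓝 0, ε < d / (1 + d) := gt_mem_nhds (by positivity)
    exact (h2.and h1).filter_mono nhdsWithin_le_nhds
  obtain ⟨ε, ⟨hεd, hεK⟩, hε⟩ := (hev.and self_mem_nhdsWithin).exists
  have hε0 : 0 < ε := hε
  obtain ⟨hsm, hN, hE⟩ := scalarEnergy_one_add_cos_le (a := a) hp₁ hp₂ hμ hd0 hε0 hεd.le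
  refine ⟨_, hsm.memH1, by rw [hN]; positivity, hE.trans_lt ?_⟩
  rw [hN]
  have h2 : 0 < ε ^ 2 := by positivity
  have h3 := mul_lt_mul_of_pos_left hεK h2
  have e : ε ^ 2 / 2 + a ^ 2 * (1 - 3 / 2 * ε ^ 2 + 9 / 4 * ε ^ 4)
        + μ * (1 + (p - 1 + d) / 2 * ε ^ 2 + (1 + d) ^ 2 * ε ^ 4)
      = (a ^ 2 + μ) * (1 + ε ^ 2 / 2) - η / 2 * ε ^ 2 + μ * d / 2 * ε ^ 2 + ε ^ 2 * (K * ε ^ 2) := by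
    rw [hη, hK]
    ring
  rw [e, hμd]
  nlinarith

/-! ### The optimal constant -/

lemma scalarEnergy_const_mul {a p μ c : ℝ} (hc : 0 < c) {u : ℝ → ℝ} (hu : IsSmoothPos u) :
    IsSmoothPos (fun x => c * u x) ∧ lqNorm 2 (fun x => c * u x) = c * lqNorm 2 u ∧
      scalarEnergy a p μ (fun x => c * u x) = c ^ 2 * scalarEnergy a p μ u := by
  have hcu : IsSmoothPos fun x => c * u x :=
    ⟨contDiff_const.mul hu.contDiff, fun x => by simp [hu.periodic x],
      fun x => mul_pos hc (hu.pos x)⟩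
  have hn : ∀ q : ℝ≥0∞, lqNorm q (fun x => c * u x) = c * lqNorm q u := fun q => by
    rw [lqNorm_const_mul, Real.norm_of_nonneg hc.le]
  refine ⟨hcu, hn 2, ?_⟩
  rw [scalarEnergy_eq a p μ hcu, scalarEnergy_eq a p μ hu, hn]
  have h1 : ∀ x, deriv (fun x => c * u x) x ^ 2 = c ^ 2 * deriv u x ^ 2 := fun x => by
    rw [deriv_const_mul_field, mul_pow]
  have h2 : ∀ x, ((c * u x) ^ 2)⁻¹ = (c ^ 2)⁻¹ * (u x ^ 2)⁻¹ := fun x => by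
    rw [mul_pow, mul_inv]
  simp only [h1, h2]
  rw [integral_const_mul, integral_const_mul, mul_inv, inv_inv]
  ring

lemma IsSmoothPos.lqNorm_two_pos {u : ℝ → ℝ} (hu : IsSmoothPos u) : 0 < lqNorm 2 u := by
  refine lt_of_le_of_ne (lqNorm_nonneg _ _) fun h => ?_
  have h1 := hu.lqNorm_two_sq
  rw [← h, zero_pow two_ne_zero] at h1
  have h2 : 0 < ∫ x, u x ^ 2 ∂circleMeasure := by
    rw [integral_pos_iff_support_of_nonneg (fun x => sq_nonneg _)
      (integrable_of_continuous (hu.continuous.pow 2)), show Function.support (fun x => u x ^ 2) =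
        univ from Set.eq_univ_of_forall fun x => (pow_pos (hu.pos x) 2).ne', measure_univ]
    exact one_pos
  linarith

lemma magneticEnergy_nonneg (a p : ℝ) {μ : ℝ} (hμ : 0 ≤ μ) (ψ : ℝ → ℂ) :
    0 ≤ magneticEnergy a p μ ψ :=
  add_nonneg (sq_nonneg _) (mul_nonneg hμ (sq_nonneg _))

/-- By homogeneity `u` may be normalised in `L²`. The reconstructed phase then gives a competitor in
the magnetic problem with the same energy. -/
lemma optimalConstant_mul_le_of_isSmoothPos (a p : ℝ) {μ : ℝ} (hμ : 0 ≤ μ) {u : ℝ → ℝ}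
    (hu : IsSmoothPos u) : optimalConstant a p μ * lqNorm 2 u ^ 2 ≤ scalarEnergy a p μ u := by
  have hN := hu.lqNorm_two_pos
  obtain ⟨h1, h2, h3⟩ := scalarEnergy_const_mul (a := a) (p := p) (μ := μ) (inv_pos.2 hN) hu
  rw [inv_mul_cancel₀ hN.ne'] at h2
  obtain ⟨ψ, hψ, hnorm, hE⟩ := h1.exists_magneticEnergy_eq a p μ
  have hle : optimalConstant a p μ ≤ (lqNorm 2 u)⁻¹ ^ 2 * scalarEnergy a p μ u := by
    refine csInf_le ⟨0, ?_⟩ ⟨ψ, hψ, ?_, hE.trans h3⟩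
    · rintro e ⟨χ, -, -, rfl⟩
      exact magneticEnergy_nonneg a p hμ χ
    · rw [← h2]
      refine lqNorm_congr_norm 2 (ae_of_all _ fun x => ?_)
      rw [hnorm x, Real.norm_of_nonneg (h1.pos x).le]
  have := mul_le_mul_of_nonneg_right hle (sq_nonneg (lqNorm 2 u))
  refine this.trans (le_of_eq ?_)
  field_simp

/-- The magnetic and the scalar problems have the same optimal constant. -/
lemma isGreatest_optimalConstant {a p μ : ℝ} (hp : 1 ≤ p) (ha₀ : 0 < a) (ha₁ : a < 1 / 2)
    (hμ : 0 ≤ μ) :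
    IsGreatest {Λ : ℝ | ∀ u : ℝ → ℝ, MemH1 u → Λ * lqNorm 2 u ^ 2 ≤ scalarEnergy a p μ u}
      (optimalConstant a p μ) := by
  constructor
  · intro u hu
    have := MemH1.inequality_of_isSmoothPos (α := optimalConstant a p μ) (β := 1) (γ := a ^ 2)
      (δ := μ) hp zero_le_one (sq_nonneg a)
      (fun v hv => by
        have := optimalConstant_mul_le_of_isSmoothPos a p hμ hv
        rwa [scalarEnergy, ← one_mul (lqNorm 2 (deriv v) ^ 2)] at this) hu
    rwa [one_mul] at this
  · intro Λ hΛ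
    refine le_csInf ⟨_, fun _ => 1, memH1_of_contDiff contDiff_const fun _ => rfl, ?_, rfl⟩ ?_
    · rw [lqNorm_const _ (by norm_num)]; simp
    · rintro e ⟨ψ, hψ, hN, rfl⟩
      have := hψ.le_magneticEnergy ha₀ ha₁ hp (fun u hu => hΛ u hu.memH1)
      rwa [hN, one_pow, mul_one] at this

/-- The case `c = 0` is included, thanks to the conventions `0⁻¹ = ∞` and `∞⁻¹ = 0`. -/
lemma invNormInvSq_const (c : ℝ) : invNormInvSq (fun _ => c) = c ^ 2 := by
  rw [invNormInvSq, lintegral_const, measure_univ, mul_one, inv_inv,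
    ENNReal.toReal_ofReal (sq_nonneg c)]

lemma scalarEnergy_const (a μ c : ℝ) {p : ℝ} (hp : 0 < p) :
    scalarEnergy a p μ (fun _ => c) = (a ^ 2 + μ) * c ^ 2 := by
  have h1 : lqNorm 2 (deriv fun _ : ℝ => c) = 0 := by
    have : (deriv fun _ : ℝ => c) = fun _ => (0 : ℝ) := funext fun x => deriv_const x c
    rw [this, lqNorm_const _ (by norm_num), norm_zero]
  rw [scalarEnergy, h1, invNormInvSq_const, lqNorm_const _ (by simpa using hp), Real.norm_eq_abs,
    sq_abs]
  ring

lemma lqNorm_two_const_sq (c : ℝ) : lqNorm 2 (fun _ : ℝ => c) ^ 2 = c ^ 2 := by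
  rw [lqNorm_const _ (by norm_num), Real.norm_eq_abs, sq_abs]

lemma MemH1.eq_const_of_lqNorm_deriv_eq_zero {u : ℝ → ℝ} (hu : MemH1 u)
    (h : lqNorm 2 (deriv u) = 0) : ∃ c : ℝ, ∀ θ, u θ = c := by
  have h1 : eLpNorm (deriv u) 2 circleMeasure = 0 := by
    rcases (ENNReal.toReal_eq_zero_iff _).1 h with h | h
    · exact h
    · exact absurd h hu.memLp_deriv.2.ne
  rw [eLpNorm_eq_zero_iff hu.memLp_deriv.1 (by norm_num)] at h1
  have h2 := ae_restrict_of_ae_circleMeasure h1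
  have hIcc : ∀ x ∈ Icc 0 (2 * Real.pi), u x = u 0 := fun x hx => by
    have hsub : uIcc 0 x ⊆ uIcc 0 (2 * Real.pi) := by
      rw [uIcc_of_le hx.1, uIcc_of_le Real.two_pi_pos.le]
      exact Icc_subset_Icc_right hx.2
    have h3 := (hu.absolutelyContinuous.mono hsub).integral_deriv_eq_sub
    rw [intervalIntegral.integral_of_le hx.1] at h3
    have h4 : ∫ t in Ioc 0 x, deriv u t = 0 :=
      integral_eq_zero_of_ae (ae_restrict_of_ae_restrict_of_subset (Ioc_subset_Ioc_right hx.2) h2)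
    linarith
  refine ⟨u 0, fun θ => ?_⟩
  obtain ⟨y, hy, e⟩ := exists_mem_Ioc_eq hu.periodic θ
  rw [e, hIcc y ⟨hy.1.le, hy.2⟩]

/-- Below the threshold the constants are optimal. -/
lemma MemH1.le_scalarEnergy {u : ℝ → ℝ} (hu : MemH1 u) {a p μ : ℝ} (hp₁ : 1 < p) (hp₂ : p < 2)
    (hμ : 0 < μ) (h : μ * (2 - p) + 4 * a ^ 2 ≤ 1) :
    (a ^ 2 + μ) * lqNorm 2 u ^ 2 ≤ scalarEnergy a p μ u ∧
      (0 < lqNorm 2 (deriv u) ^ 2 → (a ^ 2 + μ) * lqNorm 2 u ^ 2 < scalarEnergy a p μ u) := by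
  have hJ : 0 ≤ lqNorm 2 (deriv u) ^ 2 := sq_nonneg _
  have h1 := mul_le_mul_of_nonneg_left hu.critical_inequality (sq_nonneg a)
  have h3 := mul_le_mul_of_nonneg_right h hJ
  constructor
  · have h2 := mul_le_mul_of_nonneg_left (hu.beckner hp₁ hp₂) hμ.le
    rw [scalarEnergy]
    linarith
  · intro hJ'
    -- Strictness comes from the Beckner term alone, so the borderline case `μ (2 - p) + 4 a² = 1`
    -- is covered.
    have h2 := mul_lt_mul_of_pos_left (hu.beckner_strict hp₁ hp₂ hJ') hμ
    rw [scalarEnergy]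
    linarith

end MagneticRing

theorem theorem3p5 (p a μ : ℝ) (hp₁ : 1 < p) (hp₂ : p < 2) (ha₀ : 0 < a) (ha₁ : a < 1 / 2)
    (hμ : 0 < μ) :
    IsGreatest {Λ : ℝ | ∀ u : ℝ → ℝ, MagneticRing.MemH1 u →
        Λ * MagneticRing.lqNorm 2 u ^ 2 ≤ MagneticRing.scalarEnergy a p μ u}
      (MagneticRing.optimalConstant a p μ) ∧
    (μ * (2 - p) + 4 * a ^ 2 ≤ 1 →
      MagneticRing.optimalConstant a p μ = a ^ 2 + μ ∧
      ∀ u : ℝ → ℝ, MagneticRing.MemH1 u →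
        (MagneticRing.scalarEnergy a p μ u =
            MagneticRing.optimalConstant a p μ * MagneticRing.lqNorm 2 u ^ 2 ↔
          ∃ c : ℝ, ∀ θ : ℝ, u θ = c)) ∧
    (1 < μ * (2 - p) + 4 * a ^ 2 →
      MagneticRing.optimalConstant a p μ < a ^ 2 + μ ∧
      ∀ c : ℝ, c ≠ 0 →
        MagneticRing.scalarEnergy a p μ (fun _ => c) ≠
          MagneticRing.optimalConstant a p μ * MagneticRing.lqNorm 2 (fun _ : ℝ => c) ^ 2) := by
  have hp₀ : 0 < p := by linarith
  have hG := MagneticRing.isGreatest_optimalConstant (a := a) (p := p) (μ := μ) hp₁.le ha₀ ha₁ hμ.le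
  refine ⟨hG, fun h => ?_, fun h => ?_⟩
  · have heq : MagneticRing.optimalConstant a p μ = a ^ 2 + μ := by
      refine le_antisymm ?_ (hG.2 fun u hu => (hu.le_scalarEnergy hp₁ hp₂ hμ h).1)
      have h1 := hG.1 (fun _ => 1) (MagneticRing.memH1_of_contDiff contDiff_const fun _ => rfl)
      rw [MagneticRing.scalarEnergy_const a μ 1 hp₀, MagneticRing.lqNorm_two_const_sq] at h1
      linarith
    refine ⟨heq, fun u hu => ⟨fun hE => ?_, ?_⟩⟩
    · refine hu.eq_const_of_lqNorm_deriv_eq_zero ?_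
      by_contra hne
      have h1 := (hu.le_scalarEnergy hp₁ hp₂ hμ h).2
        (pow_pos (lt_of_le_of_ne (MagneticRing.lqNorm_nonneg _ _) (Ne.symm hne)) 2)
      rw [hE, heq] at h1
      exact lt_irrefl _ h1
    · rintro ⟨c, hc⟩
      rw [show u = fun _ => c from funext hc, MagneticRing.scalarEnergy_const a μ c hp₀,
        MagneticRing.lqNorm_two_const_sq, heq]
  · have hlt : MagneticRing.optimalConstant a p μ < a ^ 2 + μ := by
      obtain ⟨u, hu, hN, hE⟩ := MagneticRing.exists_scalarEnergy_lt (a := a) hp₁ hp₂ hμ h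
      exact lt_of_mul_lt_mul_right ((hG.1 u hu).trans_lt hE) hN.le
    refine ⟨hlt, fun c hc hE => ?_⟩
    -- Constants have quotient exactly `a² + μ`, so equality at some `c ≠ 0` would contradict the
    -- strict bound just obtained.
    rw [MagneticRing.scalarEnergy_const a μ c hp₀, MagneticRing.lqNorm_two_const_sq] at hE
    exact hlt.ne' (mul_right_cancel₀ (pow_ne_zero 2 hc) hE)
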